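/- Let $n\ge 1$, let $\Omega\subset\mathbb{R}^n$ be a bounded connected domain with smooth boundary and outward unit normal $\nu$, let $|\Omega|$ be its volume and $\omega_n$ the volume of the unit ball of $\mathbb{R}^n$. Let $\tau\ge 0$ and $0\le\sigma\le 1$ be constants, and consider the free plate problem with tension $\tau$ and Poisson ratio $\sigma$, $$\Delta^2u-\tau\Delta u=\Lambda u\ \text{ in }\Omega,\qquad (1-\sigma)\frac{\partial^2u}{\partial\nu^2}+\sigma\Delta u=0,\quad \tau\frac{\partial u}{\partial\nu}-(1-\sigma)\,\mathrm{div}_{\partial\Omega}\big(\nabla^2u(\nu)\big)-\frac{\partial\Delta u}{\partial\nu}=0\ \text{ on }\partial\Omega,$$ understood weakly: $u\in H^2(\Omega)\setminus\{0\}$ is an eigenfunction with eigenvalue $\Lambda$ if $a(u,v)=\Lambda\int_\Omega uv$ for all $v\in H^2(\Omega)$, where $$a(u,v)=\int_\Omega\Big[(1-\sigma)\langle\nabla^2u,\nabla^2v\rangle+\sigma\,\Delta u\,\Delta v+\tau\langle\nabla u,\nabla v\rangle\Big].$$ Let $\Lambda_1\le\Lambda_2\le\cdots$ be the eigenvalues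 counted with multiplicity (so that $\Lambda_1=0$), as given by the Rayleigh–Ritz principle, $$\Lambda_k=\inf_{V\subset H^2(\Omega),\ \dim V=k}\ \max_{u\in V\setminus\{0\}}\frac{a(u,u)}{\int_\Omega u^2},\qquad k\ge1 .$$ If $\mu_1\le\mu_2\le\cdots$ are eigenvalues of the problem whose eigenfunctions form an orthonormal basis of $L^2(\Omega)$, then $\mu_k=\Lambda_k$ for every $k\geq 1$. Moreover: (i) for every $k\ge1$, $$\sum_{j=1}^k\Lambda_j\le(2\pi)^4\frac{n}{n+4}k^{\frac{n+4}{n}}\Big(\frac{1}{\omega_n|\Omega|}\Big)^{\frac4n}+\tau(2\pi)^2\frac{n}{n+2}k^{\frac{n+2}{n}}\Big(\frac1{\omega_n|\Omega|}\Big)^{\frac2n};$$ (ii) if $\tau=0$, then for every $k\ge0$, $$\Lambda_{k+1}\le(2\pi)^4\Big(\frac{n+4}{4\omega_n|\Omega|}\Big)^{\frac4n}k^{\frac4n};$$ (iii) if $\tau>0$, then for every $k\ge0$, $$\Lambda_{k+1}\le\inf_{r>2\pi\left(\frac{k}{\omega_n|\Omega|}\right)^{1/n}}\frac{n\,\omega_n|\Omega|\Big(\frac{r^{n+4}}{n+4}+\tau\frac{r^{n+2}}{n+2}\Big)}{\omega_n|\Omega|\,r^n-k(2\pi)^n},$$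 and the infimum is a minimum when $k\ge1$. -/

import Mathlib

open MeasureTheory
open scoped ContDiff

/-- The Euclidean space `ℝⁿ`. -/
abbrev Eucl (n : ℕ) : Type := EuclideanSpace ℝ (Fin n)

/-- The real Hilbert space `L²(Ω)`. -/
abbrev L2 {n : ℕ} (Ω : Set (Eucl n)) : Type := Lp ℝ 2 (volume.restrict Ω)

/-- `Ω` is a bounded connected domain of `ℝⁿ` with smooth boundary: near every boundary point,
`Ω` is the set where a smooth function with nonvanishing differential is negative. -/
structure IsBoundedSmoothDomain {n : ℕ} (Ω : Set (Eucl n)) : Prop where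
  isOpen : IsOpen Ω
  isConnected : IsConnected Ω
  isBounded : Bornology.IsBounded Ω
  smooth_boundary : ∀ x ∈ frontier Ω, ∃ (U : Set (Eucl n)) (ρ : Eucl n → ℝ),
    IsOpen U ∧ x ∈ U ∧ ContDiffOn ℝ ∞ ρ U ∧ fderiv ℝ ρ x ≠ 0 ∧ Ω ∩ U = {y ∈ U | ρ y < 0}

/-- `v` is the weak partial derivative `∂u/∂xᵢ` on `Ω`, both functions being in `L²(Ω)`. -/
def IsWeakPartial {n : ℕ} (Ω : Set (Eucl n)) (i : Fin n) (u v : L2 Ω) : Prop :=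
  ∀ φ : Eucl n → ℝ, ContDiff ℝ ∞ φ → HasCompactSupport φ → tsupport φ ⊆ Ω →
    ∫ x in Ω, u x * fderiv ℝ φ x (EuclideanSpace.single i 1) = -∫ x in Ω, v x * φ x

theorem L2.integrable_mul_test {n : ℕ} {Ω : Set (Eucl n)} (u : L2 Ω) {f : Eucl n → ℝ}
    (hf : Continuous f) (hc : HasCompactSupport f) :
    Integrable (fun x => u x * f x) (volume.restrict Ω) :=
  MemLp.integrable_mul (p := 2) (q := 2) (Lp.memLp u)
    ((hf.memLp_of_hasCompactSupport hc).restrict Ω)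

theorem L2.integral_add_mul_test {n : ℕ} {Ω : Set (Eucl n)} (u v : L2 Ω) {f : Eucl n → ℝ}
    (hf : Continuous f) (hc : HasCompactSupport f) :
    ∫ x in Ω, (u + v : L2 Ω) x * f x = (∫ x in Ω, u x * f x) + ∫ x in Ω, v x * f x := by
  rw [← integral_add (u.integrable_mul_test hf hc) (v.integrable_mul_test hf hc)]
  refine integral_congr_ae ?_
  filter_upwards [Lp.coeFn_add u v] with x hx
  rw [hx, Pi.add_apply, add_mul]

theorem L2.integral_smul_mul_test {n : ℕ} {Ω : Set (Eucl n)} (c : ℝ) (u : L2 Ω)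
    (f : Eucl n → ℝ) :
    ∫ x in Ω, (c • u : L2 Ω) x * f x = c * ∫ x in Ω, u x * f x := by
  rw [← integral_const_mul]
  refine integral_congr_ae ?_
  filter_upwards [Lp.coeFn_smul c u] with x hx
  rw [hx, Pi.smul_apply, smul_eq_mul, mul_assoc]

theorem IsWeakPartial.add {n : ℕ} {Ω : Set (Eucl n)} {i : Fin n} {u v u' v' : L2 Ω}
    (h : IsWeakPartial Ω i u v) (h' : IsWeakPartial Ω i u' v') :
    IsWeakPartial Ω i (u + u') (v + v') := by
  intro φ hφ hc hs
  have hd : Continuous (fun x => fderiv ℝ φ x (EuclideanSpace.single i 1)) :=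
    (hφ.continuous_fderiv (by simp)).clm_apply continuous_const
  have hdc : HasCompactSupport (fun x => fderiv ℝ φ x (EuclideanSpace.single i 1)) :=
    hc.fderiv_apply ℝ _
  rw [L2.integral_add_mul_test _ _ hd hdc, L2.integral_add_mul_test _ _ hφ.continuous hc,
    h φ hφ hc hs, h' φ hφ hc hs]
  ring

theorem IsWeakPartial.smul {n : ℕ} {Ω : Set (Eucl n)} {i : Fin n} {u v : L2 Ω} (c : ℝ)
    (h : IsWeakPartial Ω i u v) : IsWeakPartial Ω i (c • u) (c • v) := by
  intro φ hφ hc hs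
  rw [L2.integral_smul_mul_test, L2.integral_smul_mul_test, h φ hφ hc hs]
  ring

theorem IsWeakPartial.zero {n : ℕ} (Ω : Set (Eucl n)) (i : Fin n) :
    IsWeakPartial Ω i 0 0 := by
  have h0 : ∀ f : Eucl n → ℝ, ∫ x in Ω, (0 : L2 Ω) x * f x = 0 := fun f => by
    simpa using L2.integral_smul_mul_test (0 : ℝ) (0 : L2 Ω) f
  intro φ _ _ _
  rw [h0, h0, neg_zero]

/-- On an open set the weak partial derivative is unique. -/
theorem IsWeakPartial.unique {n : ℕ} {Ω : Set (Eucl n)} (hΩ : IsOpen Ω) {i : Fin n}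
    {u v v' : L2 Ω} (h : IsWeakPartial Ω i u v) (h' : IsWeakPartial Ω i u v') : v = v' := by
  have hw : ∀ φ : Eucl n → ℝ, ContDiff ℝ ∞ φ → HasCompactSupport φ → tsupport φ ⊆ Ω →
      ∫ x in Ω, (v - v' : L2 Ω) x * φ x = 0 := by
    intro φ hφ hc hs
    have e := L2.integral_add_mul_test (v - v') v' hφ.continuous hc
    rw [sub_add_cancel] at e
    linarith [h φ hφ hc hs, h' φ hφ hc hs]
  have hloc : LocallyIntegrableOn (v - v' : L2 Ω) Ω volume := by
    refine locallyIntegrableOn_of_locallyIntegrable_restrict ?_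
    exact (Lp.memLp (v - v')).locallyIntegrable (by norm_num)
  have hz := hΩ.ae_eq_zero_of_integral_contDiff_smul_eq_zero hloc (fun φ hφ hc hs => by
    rw [← hw φ hφ hc hs]
    rw [← setIntegral_eq_integral_of_forall_compl_eq_zero (s := Ω)]
    · simp [mul_comm]
    · intro x hx
      have : φ x = 0 := image_eq_zero_of_notMem_tsupport (fun hx' => hx (hs hx'))
      simp [this])
  have : v - v' = 0 := by
    refine (Lp.eq_zero_iff_ae_eq_zero).2 ?_
    exact (ae_restrict_iff' hΩ.measurableSet).2 hz
  exact sub_eq_zero.1 this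

/-- The Sobolev space `H²(Ω)`, as a subspace of `L²(Ω)`: all weak partial derivatives of order
one and two exist and are in `L²(Ω)`. -/
def sobolevH2 {n : ℕ} (Ω : Set (Eucl n)) : Submodule ℝ (L2 Ω) where
  carrier := {u | ∀ i, ∃ g, IsWeakPartial Ω i u g ∧ ∀ j, ∃ h, IsWeakPartial Ω j g h}
  add_mem' := by
    intro u v hu hv i
    obtain ⟨g, hg, hg'⟩ := hu i
    obtain ⟨k, hk, hk'⟩ := hv i
    refine ⟨g + k, hg.add hk, fun j => ?_⟩
    obtain ⟨a, ha⟩ := hg' j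
    obtain ⟨b, hb⟩ := hk' j
    exact ⟨a + b, ha.add hb⟩
  zero_mem' := fun i => ⟨0, IsWeakPartial.zero Ω i, fun j => ⟨0, IsWeakPartial.zero Ω j⟩⟩
  smul_mem' := by
    intro c u hu i
    obtain ⟨g, hg, hg'⟩ := hu i
    refine ⟨c • g, hg.smul c, fun j => ?_⟩
    obtain ⟨a, ha⟩ := hg' j
    exact ⟨c • a, ha.smul c⟩

open Classical in
/-- The weak partial derivative `∂u/∂xᵢ ∈ L²(Ω)` (with value `0` if there is none). -/
noncomputable def weakPartial {n : ℕ} (Ω : Set (Eucl n)) (i : Fin n) (u : L2 Ω) : L2 Ω :=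
  if h : ∃ v, IsWeakPartial Ω i u v then h.choose else 0

/-- The entry `∂²u/∂xᵢ∂xⱼ` of the weak Hessian. -/
noncomputable def weakHess {n : ℕ} (Ω : Set (Eucl n)) (i j : Fin n) (u : L2 Ω) : L2 Ω :=
  weakPartial Ω i (weakPartial Ω j u)

/-- The bilinear form of the free plate with tension `τ` and Poisson ratio `σ`:
`∫_Ω (1 - σ) ⟨∇²u, ∇²v⟩ + σ Δu Δv + τ ⟨∇u, ∇v⟩`. -/
noncomputable def plateForm {n : ℕ} (Ω : Set (Eucl n)) (τ σ : ℝ) (u v : L2 Ω) : ℝ :=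
  ∫ x in Ω, ((1 - σ) * ∑ i, ∑ j, weakHess Ω i j u x * weakHess Ω i j v x
    + σ * ((∑ i, weakHess Ω i i u x) * ∑ i, weakHess Ω i i v x)
    + τ * ∑ i, weakPartial Ω i u x * weakPartial Ω i v x)

/-- `u` is an eigenfunction with eigenvalue `μ` of the free plate problem
`Δ²u - τΔu = μu` in `Ω`, in the weak sense. The boundary conditions
`(1 - σ) ∂²u/∂ν² + σ Δu = 0` and `τ ∂u/∂ν - (1 - σ) div_{∂Ω} (∇²u(ν)) - ∂Δu/∂ν = 0`
are the natural ones: they are encoded by testing with all of `H²(Ω)`. -/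
def IsPlateEigenfunction {n : ℕ} (Ω : Set (Eucl n)) (τ σ μ : ℝ) (u : L2 Ω) : Prop :=
  u ∈ sobolevH2 Ω ∧ u ≠ 0 ∧ ∀ v ∈ sobolevH2 Ω, plateForm Ω τ σ u v = μ * inner ℝ u v

/-- `μ 0 ≤ μ 1 ≤ …` is the list of all eigenvalues of the free plate problem, repeated according
to multiplicity: they belong to eigenfunctions that form an orthonormal basis of `L²(Ω)`. -/
def IsPlateSpectrum {n : ℕ} (Ω : Set (Eucl n)) (τ σ : ℝ) (μ : ℕ → ℝ) : Prop :=
  Monotone μ ∧ ∃ u : ℕ → L2 Ω, Orthonormal ℝ u ∧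
    (Submodule.span ℝ (Set.range u)).topologicalClosure = ⊤ ∧
    ∀ j, IsPlateEigenfunction Ω τ σ (μ j) (u j)

/-- The `k`-th eigenvalue `Λ_k` (`k = 1, 2, …`, counted with multiplicity) of the free plate, by
the Rayleigh-Ritz principle: the infimum, over the `k`-dimensional subspaces `V` of `H²(Ω)`, of
the maximum on `V \ {0}` of the Rayleigh quotient `plateForm Ω τ σ u u / ∫_Ω u²`. -/
noncomputable def plateEigenvalue {n : ℕ} (Ω : Set (Eucl n)) (τ σ : ℝ) (k : ℕ) : ℝ :=
  sInf {t : ℝ | ∃ V : Submodule ℝ (L2 Ω), V ≤ sobolevH2 Ω ∧ Module.finrank ℝ V = k ∧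
    ∀ u ∈ V, plateForm Ω τ σ u u ≤ t * ‖u‖ ^ 2}

/-- The volume `ω_n` of the unit ball of `ℝⁿ`. -/
noncomputable def unitBallVolume (n : ℕ) : ℝ := volume.real (Metric.ball (0 : Eucl n) 1)

/-- The function of `r` whose minimum bounds `Λ_{k+1}`, with `A = ω_n |Ω|`. -/
noncomputable def plateBound (n k : ℕ) (A τ r : ℝ) : ℝ :=
  n * A * (r ^ (n + 4) / (n + 4) + τ * (r ^ (n + 2) / (n + 2))) /
    (A * r ^ n - k * (2 * Real.pi) ^ n)

/-! The upper bounds come from averaging plane waves over their frequencies, in a discretised form.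
The abstract core is `sum_minMax_add_le`: if finitely many vectors `g i` satisfy Bessel's inequality
and Σ‖g i‖² > k, then Λ_1 + … + Λ_k + (Σ‖g i‖² − k) Λ_{k+1} ≤ Σ B(g i, g i). Indeed, after
diagonalising the form on their span, the family puts a weight between 0 and 1 on each eigenvector,
and such weights cannot do better than fill the lowest levels.

To find such a family, enclose Ω in a cube of side l. The normalised exponentials with frequencies
in (2π/l)ℤⁿ are orthonormal on the cube, so their restrictions to Ω still satisfy Bessel's
inequality (`sum_inner_cosWave_sinWave_le`). Their real and imaginary parts lie in H²(Ω), where no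
boundary condition is imposed. Before normalisation, each pair has total squared norm |Ω| and total
energy (‖ξ‖⁴ + τ‖ξ‖²)|Ω|, whatever σ is. Taking the frequencies in a ball of radius r and letting l
→ ∞ turns Riemann sums into integrals. With A = ω_n|Ω| this gives `sum_plateEigenvalue_add_le`:
(2π)ⁿ Σ_{j≤k} Λ_j + (A rⁿ − k(2π)ⁿ) Λ_{k+1} ≤ n A (r^{n+4}/(n+4) + τ r^{n+2}/(n+2)).

Discarding the nonnegative sum and dividing gives (iii), and the best radius for τ = 0 gives (ii).
Letting r decrease to the radius where A rⁿ = k(2π)ⁿ gives (i).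

The identification of the μ_k with the Λ_k is the classical min-max argument
(`minMax_succ_eq_of_eigenvectors`), with Parseval's identity in L² and positivity of the form. -/

/-! ### Min-max values of a nonnegative quadratic form -/

section MinMax

variable {E : Type*} [NormedAddCommGroup E] [InnerProductSpace ℝ E]

/-- The `k`-th min-max value of a quadratic form on a real inner product space. -/
noncomputable def minMax (B : LinearMap.BilinForm ℝ E) (k : ℕ) : ℝ :=
  sInf {t : ℝ | ∃ V : Submodule ℝ E, Module.finrank ℝ V = k ∧ ∀ u ∈ V, B u u ≤ t * ‖u‖ ^ 2}

/-- This bounds from below the set whose infimum is `minMax`. Dimension `k + 1` is essential: the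
zero subspace admits every `t`. -/
theorem nonneg_of_form_le {B : LinearMap.BilinForm ℝ E} (hB : ∀ u, 0 ≤ B u u) {k : ℕ} {t : ℝ}
    {V : Submodule ℝ E} (hV : Module.finrank ℝ V = k + 1) (ht : ∀ u ∈ V, B u u ≤ t * ‖u‖ ^ 2) :
    0 ≤ t := by
  have : Nontrivial V := Module.nontrivial_of_finrank_pos (R := ℝ) (by omega)
  obtain ⟨u, hu⟩ := exists_ne (0 : V)
  have hu' : 0 < ‖(u : E)‖ := norm_pos_iff.2 (by simpa using hu)
  by_contra! h
  nlinarith [hB u, ht u u.2, mul_neg_of_neg_of_pos h (pow_pos hu' 2)]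

theorem minMax_succ_nonneg {B : LinearMap.BilinForm ℝ E} (hB : ∀ u, 0 ≤ B u u) (k : ℕ) :
    0 ≤ minMax B (k + 1) :=
  Real.sInf_nonneg fun _ ⟨_, hV, ht⟩ => nonneg_of_form_le hB hV ht

theorem minMax_succ_le {B : LinearMap.BilinForm ℝ E} (hB : ∀ u, 0 ≤ B u u) {k : ℕ} {t : ℝ}
    {V : Submodule ℝ E} (hV : Module.finrank ℝ V = k + 1) (ht : ∀ u ∈ V, B u u ≤ t * ‖u‖ ^ 2) :
    minMax B (k + 1) ≤ t :=
  csInf_le ⟨0, fun _ ⟨_, hV, ht⟩ => nonneg_of_form_le hB hV ht⟩ ⟨V, hV, ht⟩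

/-- A quadratic form that is diagonal in an orthonormal family. -/
theorem form_sum_smul {B : LinearMap.BilinForm ℝ E} {ι : Type*} [DecidableEq ι]
    {e : ι → E} {lam : ι → ℝ} (hBe : ∀ i j, B (e i) (e j) = if i = j then lam i else 0)
    (s : Finset ι) (c : ι → ℝ) :
    B (∑ i ∈ s, c i • e i) (∑ i ∈ s, c i • e i) = ∑ i ∈ s, lam i * c i ^ 2 := by
  simp only [map_sum, LinearMap.sum_apply, map_smul, LinearMap.smul_apply, smul_eq_mul, hBe]
  refine Finset.sum_congr rfl fun i hi => ?_
  simp [hi]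
  ring

theorem exists_submodule_form_le_of_orthonormal {B : LinearMap.BilinForm ℝ E} {k : ℕ} {t : ℝ}
    {e : Fin k → E} (he : Orthonormal ℝ e) {lam : Fin k → ℝ}
    (hBe : ∀ i j, B (e i) (e j) = if i = j then lam i else 0) (ht : ∀ i, lam i ≤ t) :
    ∃ V : Submodule ℝ E, Module.finrank ℝ V = k ∧ ∀ u ∈ V, B u u ≤ t * ‖u‖ ^ 2 := by
  refine ⟨Submodule.span ℝ (Set.range e), by simp [finrank_span_eq_card he.linearIndependent],
    fun u hu => ?_⟩
  obtain ⟨c, rfl⟩ := (Submodule.mem_span_range_iff_exists_fun ℝ).1 hu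
  rw [form_sum_smul hBe, ← real_inner_self_eq_norm_sq, he.inner_sum, Finset.mul_sum]
  refine Finset.sum_le_sum fun i _ => ?_
  simp only [conj_trivial, ← sq]
  exact mul_le_mul_of_nonneg_right (ht i) (sq_nonneg _)

/-- The min-max principle: a complete orthonormal system of eigenvectors computes the min-max
values. -/
theorem minMax_succ_eq_of_eigenvectors {B : LinearMap.BilinForm ℝ E} (hB : ∀ u, 0 ≤ B u u)
    (hsymm : ∀ u v, B u v = B v u) {u : ℕ → E} (hu : Orthonormal ℝ u)
    (hparseval : ∀ x, HasSum (fun i => inner ℝ (u i) x ^ 2) (‖x‖ ^ 2))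
    {mu : ℕ → ℝ} (hmono : Monotone mu) (heig : ∀ j v, B (u j) v = mu j * inner ℝ (u j) v) (j : ℕ) :
    minMax B (j + 1) = mu j := by
  have hBu : ∀ i l, B (u i) (u l) = if i = l then mu i else 0 := fun i l => by
    rw [heig, orthonormal_iff_ite.1 hu]; split_ifs <;> simp
  obtain ⟨V, hV, hVle⟩ := exists_submodule_form_le_of_orthonormal (B := B) (t := mu j)
    (e := fun i : Fin (j + 1) => u i) (lam := fun i => mu i) (hu.comp _ Fin.val_injective)
    (fun i l => by simp [hBu, Fin.ext_iff]) (fun i => hmono (Nat.lt_succ_iff.1 i.2))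
  refine le_antisymm (minMax_succ_le hB hV hVle) (le_csInf ⟨mu j, V, hV, hVle⟩ ?_)
  · rintro t ⟨V, hV, ht⟩
    have : FiniteDimensional ℝ V := Module.finite_of_finrank_pos (by omega)
    -- By dimension count, a space of dimension `j + 1` contains a nonzero vector orthogonal to the
    -- first `j` eigenvectors.
    let f : V →ₗ[ℝ] (Fin j → ℝ) :=
      LinearMap.pi fun i => (innerₗ E (u i)).comp V.subtype
    obtain ⟨x, hx, hx0⟩ := (Submodule.ne_bot_iff _).1
      (LinearMap.ker_ne_bot_of_finrank_lt (f := f) (by simp [hV]))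
    have hxu : ∀ i < j, inner ℝ (u i) (x : E) = 0 := fun i hi => by
      simpa [f] using congr_fun (LinearMap.mem_ker.1 hx) ⟨i, hi⟩
    -- Bessel's inequality for the form: expand `0 ≤ B (x - p) (x - p)` for a truncated expansion
    -- `p` of `x`, where `B p p = B p x`.
    have hpartial : ∀ s : Finset ℕ, ∑ i ∈ s, mu i * inner ℝ (u i) (x : E) ^ 2 ≤ B x x := by
      intro s
      set p := ∑ i ∈ s, inner ℝ (u i) (x : E) • u i with hp
      have h1 : B p p = ∑ i ∈ s, mu i * inner ℝ (u i) (x : E) ^ 2 := form_sum_smul hBu s _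
      have h2 : B p x = ∑ i ∈ s, mu i * inner ℝ (u i) (x : E) ^ 2 := by
        simp only [hp, map_sum, LinearMap.sum_apply, map_smul, LinearMap.smul_apply, heig,
          smul_eq_mul]
        exact Finset.sum_congr rfl fun i _ => by ring
      have h3 := hB (x - p)
      simp only [map_sub, LinearMap.sub_apply, hsymm x p] at h3
      linarith
    have hle : mu j * ‖(x : E)‖ ^ 2 ≤ B x x := by
      refine hasSum_le_of_sum_le ((hparseval x).mul_left (mu j)) fun s => ?_
      refine le_trans (Finset.sum_le_sum fun i _ => ?_) (hpartial s)
      rcases lt_or_ge i j with hi | hi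
      · simp [hxu i hi]
      · exact mul_le_mul_of_nonneg_right (hmono hi) (sq_nonneg _)
    have hpos : 0 < ‖(x : E)‖ ^ 2 := pow_pos (norm_pos_iff.2 (by simpa using hx0)) 2
    exact le_of_mul_le_mul_right (hle.trans (ht x x.2)) hpos

/-- Simultaneous diagonalization of a symmetric form and the inner product. -/
theorem exists_orthonormalBasis_form_eq_sum [FiniteDimensional ℝ E] (B : LinearMap.BilinForm ℝ E)
    (hsymm : ∀ u v, B u v = B v u) {N : ℕ} (hN : Module.finrank ℝ E = N) :
    ∃ (e : OrthonormalBasis (Fin N) ℝ E) (lam : Fin N → ℝ), Monotone lam ∧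
      ∀ i x, B (e i) x = lam i * inner ℝ (e i) x := by
  have : CompleteSpace E := FiniteDimensional.complete ℝ E
  -- The sign turns the decreasing order of `eigenvalues` into an increasing `lam`.
  let T : E →ₗ[ℝ] E := -((InnerProductSpace.toDual ℝ E).symm.toLinearEquiv.toLinearMap ∘ₗ
    LinearMap.toContinuousLinearMap.toLinearMap ∘ₗ B)
  have hT : ∀ x y, inner ℝ (T x) y = -B x y := fun x y => by simp [T]
  have hTs : T.IsSymmetric := fun x y => by
    rw [hT, real_inner_comm, hT, hsymm]
  refine ⟨hTs.eigenvectorBasis hN, fun i => -hTs.eigenvalues hN i,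
    fun i j h => neg_le_neg (hTs.eigenvalues_antitone hN h), fun i x => ?_⟩
  have := hT (hTs.eigenvectorBasis hN i) x
  rw [hTs.apply_eigenvectorBasis, inner_smul_left] at this
  simp at this
  linarith

/-- Bathtub principle: weights in [0, 1] of total mass at least `k` cost least when they fill the
lowest levels, the excess being charged at level `k`. -/
theorem sum_add_mul_le_sum_mul {N k : ℕ} (hk : k < N) {lam p : Fin N → ℝ} (hlam : Monotone lam)
    (hp0 : ∀ i, 0 ≤ p i) (hp1 : ∀ i, p i ≤ 1) {L : ℕ → ℝ} (hL : ∀ i : Fin N, L i ≤ lam i)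
    (hT : k ≤ ∑ i, p i) :
    ∑ j ∈ Finset.range k, L j + (∑ i, p i - k) * L k ≤ ∑ i, lam i * p i := by
  set m := lam ⟨k, hk⟩ with hm
  -- Compare every level with `m`: below index `k` the factor `lam i - m` is nonpositive and `p i ≤
  -- 1`; from `k` on it is nonnegative and `0 ≤ p i`.
  have hterm : ∀ i : Fin N, m * p i + (if (i : ℕ) < k then L i - m else 0) ≤ lam i * p i := by
    intro i
    split_ifs with h
    · have h1 : lam i ≤ m := hlam (Fin.le_def.2 h.le)
      nlinarith [hL i, hp1 i, hp0 i]
    · have h1 : m ≤ lam i := hlam (Fin.le_def.2 (not_lt.1 h))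
      nlinarith [hp0 i]
  have hsum := Finset.sum_le_sum fun i (_ : i ∈ Finset.univ) => hterm i
  rw [Finset.sum_add_distrib, ← Finset.mul_sum,
    Fin.sum_univ_eq_sum_range (fun i => if i < k then L i - m else 0) N,
    ← Finset.sum_filter] at hsum
  have hf : (Finset.range N).filter (· < k) = Finset.range k := by
    ext i; simp; omega
  rw [hf, Finset.sum_sub_distrib] at hsum
  simp at hsum
  nlinarith [hL ⟨k, hk⟩]

/-- The averaged variational principle: a finite family satisfying Bessel's inequality is a trial
density for the sum of the first min-max values. -/
theorem sum_minMax_add_le {B : LinearMap.BilinForm ℝ E} (hB : ∀ u, 0 ≤ B u u)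
    (hsymm : ∀ u v, B u v = B v u) {ι : Type*} [Fintype ι] (g : ι → E)
    (hbessel : ∀ x, ∑ i, inner ℝ (g i) x ^ 2 ≤ ‖x‖ ^ 2) {k : ℕ} (hT : k < ∑ i, ‖g i‖ ^ 2) :
    ∑ j ∈ Finset.range k, minMax B (j + 1) + (∑ i, ‖g i‖ ^ 2 - k) * minMax B (k + 1) ≤
      ∑ i, B (g i) (g i) := by
  set W := Submodule.span ℝ (Set.range g) with hW
  have hg : ∀ i, g i ∈ W := fun i => Submodule.subset_span ⟨i, rfl⟩
  have : FiniteDimensional ℝ W := FiniteDimensional.span_of_finite ℝ (Set.finite_range g)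
  let BW : LinearMap.BilinForm ℝ W := B.compl₁₂ W.subtype W.subtype
  have hBW : ∀ x y : W, BW x y = B x y := fun x y => rfl
  obtain ⟨N, hN⟩ : ∃ N, Module.finrank ℝ W = N := ⟨_, rfl⟩
  obtain ⟨e, lam, hlam, he⟩ := exists_orthonormalBasis_form_eq_sum BW
    (fun x y => hsymm x y) hN
  -- The weight of the family on the eigenvector `e j`. Bessel's inequality at `e j` gives `p j ≤
  -- 1`, and the weights add up to the sum of the `‖g i‖ ^ 2`.
  let p : Fin N → ℝ := fun j => ∑ i, inner ℝ (g i) (e j : E) ^ 2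
  have hp1 : ∀ j, p j ≤ 1 := fun j => by
    have := hbessel (e j)
    rwa [show ‖(e j : E)‖ = 1 from e.orthonormal.1 j, one_pow] at this
  have hp0 : ∀ j, 0 ≤ p j := fun j => Finset.sum_nonneg fun i _ => sq_nonneg _
  have hpsum : ∑ j, p j = ∑ i, ‖g i‖ ^ 2 := by
    rw [Finset.sum_comm]
    refine Finset.sum_congr rfl fun i _ => ?_
    simpa using e.sum_sq_inner_left (⟨g i, hg i⟩ : W)
  have hform : ∑ i, B (g i) (g i) = ∑ j, lam j * p j := by
    simp only [p, Finset.mul_sum]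
    rw [Finset.sum_comm]
    refine Finset.sum_congr rfl fun i _ => ?_
    have h1 := e.sum_repr (⟨g i, hg i⟩ : W)
    have h2 : B (g i) (g i) = BW ⟨g i, hg i⟩ ⟨g i, hg i⟩ := rfl
    rw [h2]
    conv_lhs => rw [← h1]
    rw [form_sum_smul (lam := lam)
      (fun a b => by rw [he, orthonormal_iff_ite.1 e.orthonormal]; split_ifs <;> simp)]
    refine Finset.sum_congr rfl fun j _ => ?_
    rw [e.repr_apply_apply, real_inner_comm]; rfl
  -- Weights at most 1 with sum exceeding `k` need more than `k` levels, so level `k` exists in the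
  -- span.
  have hkN : k < N := by
    have : ∑ j, p j ≤ ∑ j : Fin N, (1 : ℝ) := Finset.sum_le_sum fun j _ => hp1 j
    rw [hpsum] at this
    simp at this
    exact_mod_cast hT.trans_le this
  rw [hform, ← hpsum]
  refine sum_add_mul_le_sum_mul (L := fun j => minMax B (j + 1)) hkN hlam hp0 hp1 (fun i => ?_)
    (by rw [hpsum]; exact hT.le)
  have hi : (i : ℕ) + 1 ≤ N := i.2
  -- The first `i + 1` eigenvectors of the restricted form span a trial space for the min-max value
  -- on all of `E`.
  have hon : Orthonormal ℝ fun a : Fin (i + 1) => (e (Fin.castLE hi a) : E) :=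
    (e.orthonormal.comp _ (Fin.castLE_injective hi)).comp_linearIsometry W.subtypeₗᵢ
  obtain ⟨V, hV, hVle⟩ := exists_submodule_form_le_of_orthonormal (B := B) (t := lam i) hon
    (lam := fun a => lam (Fin.castLE hi a))
    (fun a b => by
      rw [← hBW, he, orthonormal_iff_ite.1 e.orthonormal]
      split_ifs <;> simp_all)
    (fun a => hlam (Fin.le_def.2 (by simpa using Nat.lt_succ_iff.1 a.2)))
  exact minMax_succ_le hB hV hVle

end MinMax

/-! ### The free plate form on H²(Ω) and its spectrum -/

section PlateForm

variable {n : ℕ} {Ω : Set (Eucl n)}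

theorem L2.integrable_mul (u v : L2 Ω) :
    Integrable (fun x => u x * v x) (volume.restrict Ω) :=
  MemLp.integrable_mul (p := 2) (q := 2) (Lp.memLp u) (Lp.memLp v)

theorem L2.inner_eq_integral_mul (u v : L2 Ω) : inner ℝ u v = ∫ x in Ω, u x * v x := by
  rw [MeasureTheory.L2.inner_def]
  exact integral_congr_ae (.of_forall fun x => by simp [mul_comm])

theorem L2.coeFn_sum {ι : Type*} [Fintype ι] (u : ι → L2 Ω) :
    ∀ᵐ x ∂volume.restrict Ω, (∑ i, u i : L2 Ω) x = ∑ i, u i x := by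
  filter_upwards [Lp.coeFn_finsetSum (s := Finset.univ) u] with x hx
  rw [hx, Finset.sum_apply]

/-- Products of L² functions are integrable, so the integral splits. In terms of inner products,
bilinearity and positivity become formal. -/
theorem plateForm_eq_inner (τ σ : ℝ) (u v : L2 Ω) :
    plateForm Ω τ σ u v =
      (1 - σ) * ∑ i, ∑ j, inner ℝ (weakHess Ω i j u) (weakHess Ω i j v) +
        σ * inner ℝ (∑ i, weakHess Ω i i u) (∑ i, weakHess Ω i i v) +
        τ * ∑ i, inner ℝ (weakPartial Ω i u) (weakPartial Ω i v) := by
  have hlap : inner ℝ (∑ i, weakHess Ω i i u) (∑ i, weakHess Ω i i v) =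
      ∫ x in Ω, (∑ i, weakHess Ω i i u x) * ∑ i, weakHess Ω i i v x := by
    rw [L2.inner_eq_integral_mul]
    refine integral_congr_ae ?_
    filter_upwards [L2.coeFn_sum fun i => weakHess Ω i i u,
      L2.coeFn_sum fun i => weakHess Ω i i v] with x hu hv
    rw [hu, hv]
  have hilap : Integrable
      (fun x => (∑ i, weakHess Ω i i u x) * ∑ i, weakHess Ω i i v x) (volume.restrict Ω) := by
    simp only [Finset.sum_mul_sum]
    exact integrable_finsetSum _ fun i _ => integrable_finsetSum _ fun j _ =>
      L2.integrable_mul _ _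
  have hih : Integrable (fun x => ∑ i, ∑ j, weakHess Ω i j u x * weakHess Ω i j v x)
      (volume.restrict Ω) :=
    integrable_finsetSum _ fun i _ => integrable_finsetSum _ fun j _ => L2.integrable_mul _ _
  have hig : Integrable (fun x => ∑ i, weakPartial Ω i u x * weakPartial Ω i v x)
      (volume.restrict Ω) :=
    integrable_finsetSum _ fun i _ => L2.integrable_mul _ _
  rw [hlap]
  simp only [L2.inner_eq_integral_mul]
  unfold plateForm
  rw [integral_add (by exact (hih.const_mul _).add (hilap.const_mul _)) (hig.const_mul _),
    integral_add (hih.const_mul _) (hilap.const_mul _), integral_const_mul, integral_const_mul,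
    integral_const_mul, integral_finsetSum _ fun i _ => integrable_finsetSum _ fun j _ =>
      L2.integrable_mul _ _, integral_finsetSum _ fun i _ => L2.integrable_mul _ _]
  simp only [integral_finsetSum _ fun j _ =>
      L2.integrable_mul (weakHess Ω _ j u) (weakHess Ω _ j v)]

theorem IsWeakPartial.weakPartial_eq (hΩ : IsOpen Ω) {i : Fin n} {u v : L2 Ω}
    (h : IsWeakPartial Ω i u v) : weakPartial Ω i u = v := by
  have hex : ∃ v, IsWeakPartial Ω i u v := ⟨v, h⟩
  rw [weakPartial, dif_pos hex]
  exact hex.choose_spec.unique hΩ h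

theorem isWeakPartial_weakPartial (hΩ : IsOpen Ω) {i : Fin n} {u : L2 Ω}
    (hu : u ∈ sobolevH2 Ω) : IsWeakPartial Ω i u (weakPartial Ω i u) := by
  obtain ⟨g, hg, -⟩ := hu i
  rwa [hg.weakPartial_eq hΩ]

theorem isWeakPartial_weakHess (hΩ : IsOpen Ω) {i j : Fin n} {u : L2 Ω}
    (hu : u ∈ sobolevH2 Ω) : IsWeakPartial Ω i (weakPartial Ω j u) (weakHess Ω i j u) := by
  obtain ⟨g, hg, hg'⟩ := hu j
  obtain ⟨h, hh⟩ := hg' i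
  rw [weakHess, hg.weakPartial_eq hΩ, hh.weakPartial_eq hΩ]
  exact hh

/-- The weak partial derivative, as a linear map on `H²(Ω)`. -/
noncomputable def weakPartialₗ (hΩ : IsOpen Ω) (i : Fin n) : sobolevH2 Ω →ₗ[ℝ] L2 Ω where
  toFun u := weakPartial Ω i u
  map_add' u v :=
    ((isWeakPartial_weakPartial hΩ u.2).add (isWeakPartial_weakPartial hΩ v.2)).weakPartial_eq hΩ
  map_smul' c u := ((isWeakPartial_weakPartial hΩ u.2).smul c).weakPartial_eq hΩ

/-- The entries of the weak Hessian, as linear maps on `H²(Ω)`. -/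
noncomputable def weakHessₗ (hΩ : IsOpen Ω) (i j : Fin n) : sobolevH2 Ω →ₗ[ℝ] L2 Ω where
  toFun u := weakHess Ω i j u
  map_add' u v := by
    have h := (weakPartialₗ hΩ j).map_add u v
    change weakPartial Ω i (weakPartialₗ hΩ j (u + v)) = _
    rw [h]
    exact ((isWeakPartial_weakHess hΩ u.2).add (isWeakPartial_weakHess hΩ v.2)).weakPartial_eq hΩ
  map_smul' c u := by
    have h := (weakPartialₗ hΩ j).map_smul c u
    change weakPartial Ω i (weakPartialₗ hΩ j (c • u)) = _
    rw [h]
    exact ((isWeakPartial_weakHess hΩ u.2).smul c).weakPartial_eq hΩ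

/-- The free plate form, as a bilinear form on `H²(Ω)`. -/
noncomputable def plateBilin (hΩ : IsOpen Ω) (τ σ : ℝ) : LinearMap.BilinForm ℝ (sobolevH2 Ω) :=
  (1 - σ) • ∑ i, ∑ j, (innerₗ (L2 Ω)).compl₁₂ (weakHessₗ hΩ i j) (weakHessₗ hΩ i j) +
    σ • (innerₗ (L2 Ω)).compl₁₂ (∑ i, weakHessₗ hΩ i i) (∑ i, weakHessₗ hΩ i i) +
    τ • ∑ i, (innerₗ (L2 Ω)).compl₁₂ (weakPartialₗ hΩ i) (weakPartialₗ hΩ i)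

theorem plateBilin_apply (hΩ : IsOpen Ω) (τ σ : ℝ) (u v : sobolevH2 Ω) :
    plateBilin hΩ τ σ u v = plateForm Ω τ σ u v := by
  rw [plateForm_eq_inner]
  simp [plateBilin, weakHessₗ, weakPartialₗ, LinearMap.sum_apply, inner_sum, sum_inner]

theorem plateForm_comm (τ σ : ℝ) (u v : L2 Ω) : plateForm Ω τ σ u v = plateForm Ω τ σ v u := by
  simp only [plateForm, mul_comm]

theorem plateForm_self_nonneg {τ σ : ℝ} (hτ : 0 ≤ τ) (hσ₀ : 0 ≤ σ) (hσ₁ : σ ≤ 1) (u : L2 Ω) :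
    0 ≤ plateForm Ω τ σ u u := by
  rw [plateForm_eq_inner]
  have : 0 ≤ 1 - σ := by linarith
  simp only [real_inner_self_eq_norm_sq]
  positivity

/-- H²(Ω) is viewed as an inner product space with the L² product. Its subspaces correspond to the
subspaces of L²(Ω) contained in it, with the same dimension. -/
theorem plateEigenvalue_eq_minMax (hΩ : IsOpen Ω) (τ σ : ℝ) (k : ℕ) :
    plateEigenvalue Ω τ σ k = minMax (plateBilin hΩ τ σ) k := by
  unfold plateEigenvalue minMax
  congr 1
  ext t
  constructor
  · rintro ⟨V, hV, hk, ht⟩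
    refine ⟨V.submoduleOf (sobolevH2 Ω), ?_, fun u hu => ?_⟩
    · rw [(Submodule.submoduleOfEquivOfLe hV).finrank_eq, hk]
    · rw [plateBilin_apply]
      exact ht u hu
  · rintro ⟨V, hk, ht⟩
    refine ⟨V.map (sobolevH2 Ω).subtype, Submodule.map_subtype_le _ _, ?_, ?_⟩
    · rw [Submodule.finrank_map_subtype_eq, hk]
    · rintro _ ⟨u, hu, rfl⟩
      have := ht u hu
      rwa [plateBilin_apply] at this

theorem IsPlateSpectrum.eq_plateEigenvalue (hΩ : IsOpen Ω) {τ σ : ℝ} (hτ : 0 ≤ τ) (hσ₀ : 0 ≤ σ)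
    (hσ₁ : σ ≤ 1) {μ : ℕ → ℝ} (h : IsPlateSpectrum Ω τ σ μ) (j : ℕ) :
    μ j = plateEigenvalue Ω τ σ (j + 1) := by
  obtain ⟨hmono, u, hu, hdense, heig⟩ := h
  rw [plateEigenvalue_eq_minMax hΩ]
  refine (minMax_succ_eq_of_eigenvectors (u := fun i => (⟨u i, (heig i).1⟩ : sobolevH2 Ω))
    (fun v => ?_) (fun v w => ?_) ?_ (fun x => ?_) hmono (fun i v => ?_) j).symm
  · rw [plateBilin_apply]; exact plateForm_self_nonneg hτ hσ₀ hσ₁ _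
  · rw [plateBilin_apply, plateBilin_apply, plateForm_comm]
  · exact (sobolevH2 Ω).subtypeₗᵢ.orthonormal_comp_iff.1 hu
  · have := (HilbertBasis.mk hu hdense.ge).hasSum_inner_mul_inner (x : L2 Ω) x
    simp only [HilbertBasis.coe_mk, real_inner_self_eq_norm_sq] at this
    simpa only [Submodule.coe_inner, Submodule.coe_norm, sq, real_inner_comm] using this
  · rw [plateBilin_apply]
    exact (heig i).2.2 v v.2

end PlateForm

/-! ### Plane waves as trial functions -/

section PlaneWaves

variable {n : ℕ} {Ω : Set (Eucl n)}

theorem memLp_restrict_of_continuous (hΩ : Bornology.IsBounded Ω) {F : Type*}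
    [NormedAddCommGroup F] {f : Eucl n → F} (hf : Continuous f) :
    MemLp f 2 (volume.restrict Ω) := by
  have hK := hΩ.isCompact_closure
  have : IsFiniteMeasure (volume.restrict (closure Ω)) := ⟨by simpa using hK.measure_lt_top⟩
  obtain ⟨C, hC⟩ := hK.exists_bound_of_continuousOn hf.continuousOn
  refine MemLp.mono_measure (Measure.restrict_mono subset_closure le_rfl)
    (MemLp.of_bound hf.aestronglyMeasurable C ?_)
  exact (ae_restrict_iff' isClosed_closure.measurableSet).2 (.of_forall hC)

/-- A test function supported in Ω extends the integrals to all of ℝⁿ, where integration by parts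
has no boundary term. -/
theorem isWeakPartial_toLp {i : Fin n} {f f' : Eucl n → ℝ} (hf : ContDiff ℝ ∞ f)
    (hf' : ∀ x, fderiv ℝ f x (EuclideanSpace.single i 1) = f' x)
    (hm : MemLp f 2 (volume.restrict Ω)) (hm' : MemLp f' 2 (volume.restrict Ω)) :
    IsWeakPartial Ω i (hm.toLp f) (hm'.toLp f') := by
  intro φ hφ hc hs
  have hfd : Continuous f' := by
    rw [← funext hf']
    exact (hf.continuous_fderiv (by simp)).clm_apply continuous_const
  have hd : Continuous (fun x => fderiv ℝ φ x (EuclideanSpace.single i 1)) :=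
    (hφ.continuous_fderiv (by simp)).clm_apply continuous_const
  have hdc : HasCompactSupport (fun x => fderiv ℝ φ x (EuclideanSpace.single i 1)) :=
    hc.fderiv_apply ℝ _
  have h0 : ∀ x, x ∉ Ω → φ x = 0 := fun x hx =>
    image_eq_zero_of_notMem_tsupport fun h => hx (hs h)
  have h0' : ∀ x, x ∉ Ω → fderiv ℝ φ x (EuclideanSpace.single i 1) = 0 := fun x hx => by
    rw [image_eq_zero_of_notMem_tsupport (f := fderiv ℝ φ)
      fun h => hx (hs (tsupport_fderiv_subset ℝ h)), zero_apply]
  have hl : ∫ x in Ω, hm.toLp f x * fderiv ℝ φ x (EuclideanSpace.single i 1) =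
      ∫ x, f x * fderiv ℝ φ x (EuclideanSpace.single i 1) := by
    rw [← setIntegral_eq_integral_of_forall_compl_eq_zero (s := Ω)
      (f := fun x => f x * fderiv ℝ φ x (EuclideanSpace.single i 1))
      fun x hx => by rw [h0' x hx, mul_zero]]
    refine integral_congr_ae ?_
    filter_upwards [hm.coeFn_toLp] with x hx
    rw [hx]
  have hr : ∫ x in Ω, hm'.toLp f' x * φ x = ∫ x, f' x * φ x := by
    rw [← setIntegral_eq_integral_of_forall_compl_eq_zero (s := Ω)
      (f := fun x => f' x * φ x)
      fun x hx => by rw [h0 x hx, mul_zero]]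
    refine integral_congr_ae ?_
    filter_upwards [hm'.coeFn_toLp] with x hx
    rw [hx]
  rw [hl, hr, integral_mul_fderiv_eq_neg_fderiv_mul_of_integrable]
  · simp only [hf']
  · simp only [hf']
    exact (hfd.mul hφ.continuous).integrable_of_hasCompactSupport hc.mul_left
  · exact (hf.continuous.mul hd).integrable_of_hasCompactSupport hdc.mul_left
  · exact (hf.continuous.mul hφ.continuous).integrable_of_hasCompactSupport hc.mul_left
  · exact fun x _ => (hf.differentiable (by simp)) x
  · exact fun x _ => (hφ.differentiable (by simp)) x

/-- The function `x ↦ cos ⟨ξ, x⟩` on a bounded set `Ω`. -/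
noncomputable def cosWave (hΩ : Bornology.IsBounded Ω) (ξ : Eucl n) : L2 Ω :=
  (memLp_restrict_of_continuous hΩ (f := fun x => Real.cos (inner ℝ ξ x)) (by fun_prop)).toLp _

/-- The function `x ↦ sin ⟨ξ, x⟩` on a bounded set `Ω`. -/
noncomputable def sinWave (hΩ : Bornology.IsBounded Ω) (ξ : Eucl n) : L2 Ω :=
  (memLp_restrict_of_continuous hΩ (f := fun x => Real.sin (inner ℝ ξ x)) (by fun_prop)).toLp _

theorem coeFn_cosWave (hΩ : Bornology.IsBounded Ω) (ξ : Eucl n) :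
    cosWave hΩ ξ =ᵐ[volume.restrict Ω] fun x => Real.cos (inner ℝ ξ x) :=
  MemLp.coeFn_toLp _

theorem coeFn_sinWave (hΩ : Bornology.IsBounded Ω) (ξ : Eucl n) :
    sinWave hΩ ξ =ᵐ[volume.restrict Ω] fun x => Real.sin (inner ℝ ξ x) :=
  MemLp.coeFn_toLp _

theorem isWeakPartial_cosWave (hΩ : Bornology.IsBounded Ω) (ξ : Eucl n)
    (i : Fin n) : IsWeakPartial Ω i (cosWave hΩ ξ) (-ξ i • sinWave hΩ ξ) := by
  rw [sinWave, ← MemLp.toLp_const_smul]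
  refine isWeakPartial_toLp (by exact (contDiff_const.inner ℝ contDiff_id).cos) (fun x => ?_) _ _
  have h1 : HasFDerivAt (fun x : Eucl n => inner ℝ ξ x) (innerSL ℝ ξ) x :=
    (innerSL ℝ ξ).hasFDerivAt
  rw [h1.cos.fderiv]
  simp [mul_comm, EuclideanSpace.inner_single_right]

theorem isWeakPartial_sinWave (hΩ : Bornology.IsBounded Ω) (ξ : Eucl n)
    (i : Fin n) : IsWeakPartial Ω i (sinWave hΩ ξ) (ξ i • cosWave hΩ ξ) := by
  rw [cosWave, ← MemLp.toLp_const_smul]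
  refine isWeakPartial_toLp (by exact (contDiff_const.inner ℝ contDiff_id).sin) (fun x => ?_) _ _
  have h1 : HasFDerivAt (fun x : Eucl n => inner ℝ ξ x) (innerSL ℝ ξ) x :=
    (innerSL ℝ ξ).hasFDerivAt
  rw [h1.sin.fderiv]
  simp [mul_comm, EuclideanSpace.inner_single_right]

theorem cosWave_mem (hΩ : Bornology.IsBounded Ω) (ξ : Eucl n) :
    cosWave hΩ ξ ∈ sobolevH2 Ω := fun i =>
  ⟨_, isWeakPartial_cosWave hΩ ξ i, fun j => ⟨_, (isWeakPartial_sinWave hΩ ξ j).smul _⟩⟩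

theorem sinWave_mem (hΩ : Bornology.IsBounded Ω) (ξ : Eucl n) :
    sinWave hΩ ξ ∈ sobolevH2 Ω := fun i =>
  ⟨_, isWeakPartial_sinWave hΩ ξ i, fun j => ⟨_, (isWeakPartial_cosWave hΩ ξ j).smul _⟩⟩

theorem norm_sq_cosWave_add_norm_sq_sinWave (hΩ : Bornology.IsBounded Ω) (ξ : Eucl n) :
    ‖cosWave hΩ ξ‖ ^ 2 + ‖sinWave hΩ ξ‖ ^ 2 = volume.real Ω := by
  rw [← real_inner_self_eq_norm_sq, ← real_inner_self_eq_norm_sq, L2.inner_eq_integral_mul,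
    L2.inner_eq_integral_mul, ← integral_add (L2.integrable_mul _ _) (L2.integrable_mul _ _)]
  trans ∫ x in Ω, (1 : ℝ)
  · refine integral_congr_ae ?_
    filter_upwards [coeFn_cosWave hΩ ξ, coeFn_sinWave hΩ ξ] with x h1 h2
    rw [h1, h2, ← sq, ← sq, Real.cos_sq_add_sin_sq]
  · simp

theorem sum_mul_sq_eq_norm_pow_four (ξ : Eucl n) : ∑ i, ∑ j, (ξ i * ξ j) ^ 2 = ‖ξ‖ ^ 4 := by
  simp only [mul_pow]
  rw [← Finset.sum_mul_sum, ← EuclideanSpace.real_norm_sq_eq]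
  ring

/-- The Hessian of either wave is −ξξᵀ times the wave, so its squared norm and the square of its
trace carry the same factor ‖ξ‖⁴, and the weights 1 − σ and σ add up to 1. Adding the two waves
removes the dependence on x through cos² + sin² = 1. -/
theorem plateForm_cosWave_add_plateForm_sinWave (ho : IsOpen Ω) (hΩ : Bornology.IsBounded Ω)
    (τ σ : ℝ) (ξ : Eucl n) :
    plateForm Ω τ σ (cosWave hΩ ξ) (cosWave hΩ ξ) + plateForm Ω τ σ (sinWave hΩ ξ) (sinWave hΩ ξ) =
      (‖ξ‖ ^ 4 + τ * ‖ξ‖ ^ 2) * volume.real Ω := by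
  have hc : ∀ i, weakPartial Ω i (cosWave hΩ ξ) = -ξ i • sinWave hΩ ξ := fun i =>
    (isWeakPartial_cosWave hΩ ξ i).weakPartial_eq ho
  have hs : ∀ i, weakPartial Ω i (sinWave hΩ ξ) = ξ i • cosWave hΩ ξ := fun i =>
    (isWeakPartial_sinWave hΩ ξ i).weakPartial_eq ho
  have hcc : ∀ i j, weakHess Ω i j (cosWave hΩ ξ) = -(ξ i * ξ j) • cosWave hΩ ξ := fun i j => by
    rw [weakHess, hc, ((isWeakPartial_sinWave hΩ ξ i).smul _).weakPartial_eq ho, smul_smul]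
    congr 1; ring
  have hss : ∀ i j, weakHess Ω i j (sinWave hΩ ξ) = -(ξ i * ξ j) • sinWave hΩ ξ := fun i j => by
    rw [weakHess, hs, ((isWeakPartial_cosWave hΩ ξ i).smul _).weakPartial_eq ho, smul_smul]
    congr 1; ring
  have hlap : ∑ i, -(ξ i * ξ i) = -‖ξ‖ ^ 2 := by
    rw [Finset.sum_neg_distrib, EuclideanSpace.real_norm_sq_eq]
    simp only [sq]
  rw [← norm_sq_cosWave_add_norm_sq_sinWave hΩ ξ, plateForm_eq_inner, plateForm_eq_inner]
  simp only [hc, hs, hcc, hss, ← Finset.sum_smul, hlap, real_inner_self_eq_norm_sq, norm_smul,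
    mul_pow, ← Finset.sum_mul, Real.norm_eq_abs, sq_abs, abs_neg]
  simp only [← mul_pow, sum_mul_sq_eq_norm_pow_four]
  rw [← EuclideanSpace.real_norm_sq_eq]
  ring

end PlaneWaves

/-! ### Bessel's inequality through Fourier series on a cube -/

section Bessel

variable {n : ℕ} {Ω : Set (Eucl n)}

/-- The cube of side `l` centered at the origin. -/
def centeredCube (n : ℕ) (l : ℝ) : Set (Eucl n) :=
  WithLp.ofLp ⁻¹' Set.univ.pi fun _ => Set.Ioc (-(l / 2)) (l / 2)

theorem subset_centeredCube {R l : ℝ} (hΩ : Ω ⊆ Metric.closedBall 0 R) (hl : 2 * R < l) :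
    Ω ⊆ centeredCube n l := by
  intro x hx i _
  have h1 : ‖x‖ ≤ R := by simpa using hΩ hx
  have h2 : |x i| ≤ ‖x‖ := by simpa using PiLp.norm_apply_le x i
  constructor
  · linarith [neg_abs_le (x i)]
  · linarith [le_abs_self (x i)]

theorem isBounded_centeredCube (n : ℕ) (l : ℝ) : Bornology.IsBounded (centeredCube n l) := by
  have h : Bornology.IsBounded (Set.univ.pi fun _ : Fin n => Set.Ioc (-(l / 2)) (l / 2)) :=
    Bornology.IsBounded.pi fun _ => Metric.isBounded_Ioc _ _
  exact (PiLp.antilipschitzWith_ofLp 2 (fun _ : Fin n => ℝ)).isBounded_preimage h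

theorem volume_real_centeredCube (n : ℕ) {l : ℝ} (hl : 0 ≤ l) :
    volume.real (centeredCube n l) = l ^ n := by
  rw [centeredCube, Measure.real, (PiLp.volume_preserving_ofLp (Fin n)).measure_preimage
    (MeasurableSet.univ_pi fun _ => measurableSet_Ioc).nullMeasurableSet, Real.volume_pi_Ioc]
  simp [hl]

theorem setIntegral_Ioc_exp_eq_zero {l a : ℝ} (hl : 0 < l) (ha : a ≠ 0)
    (hint : ∃ z : ℤ, l * a = 2 * Real.pi * z) :
    ∫ t in Set.Ioc (-(l / 2)) (l / 2), Complex.exp (a * t * Complex.I) = 0 := by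
  obtain ⟨z, hz⟩ := hint
  rw [← intervalIntegral.integral_of_le (by linarith)]
  have hc : (a * Complex.I : ℂ) ≠ 0 := by simp [ha]
  have h := integral_exp_mul_complex (a := -(l / 2)) (b := l / 2) hc
  have hexp : Complex.exp (a * Complex.I * (l / 2 : ℝ)) =
      Complex.exp (a * Complex.I * (-(l / 2) : ℝ)) := by
    rw [Complex.exp_eq_exp_iff_exists_int]
    refine ⟨z, ?_⟩
    have hz' : (l * a : ℂ) = 2 * Real.pi * z := by exact_mod_cast hz
    push_cast
    linear_combination Complex.I * hz'
  rw [hexp, sub_self, zero_div] at h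
  rw [← h]
  exact intervalIntegral.integral_congr fun t _ => by ring_nf

/-- Plane waves of nonzero frequency in the lattice dual to `(lℤ)ⁿ` have mean zero on the cube. -/
theorem setIntegral_centeredCube_exp_eq_zero {l : ℝ} (hl : 0 < l) {ξ : Eucl n} (hξ : ξ ≠ 0)
    (hint : ∀ i, ∃ z : ℤ, l * ξ i = 2 * Real.pi * z) :
    ∫ y in centeredCube n l, Complex.exp ((inner ℝ ξ y : ℝ) * Complex.I) = 0 := by
  have hprod : ∀ y : Eucl n, Complex.exp ((inner ℝ ξ y : ℝ) * Complex.I) =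
      (fun t : Fin n → ℝ => ∏ i, Complex.exp (ξ i * t i * Complex.I)) (WithLp.ofLp y) := by
    intro y
    simp only [← Complex.exp_sum, PiLp.inner_apply, ← Finset.sum_mul]
    congr 2
    push_cast
    exact Finset.sum_congr rfl fun i _ => by simp [mul_comm]
  simp only [hprod]
  rw [centeredCube, (PiLp.volume_preserving_ofLp (Fin n)).setIntegral_preimage_emb
    (MeasurableEquiv.toLp 2 (Fin n → ℝ)).symm.measurableEmbedding
    (fun t : Fin n → ℝ => ∏ i, Complex.exp (ξ i * t i * Complex.I)), volume_pi,
    Measure.restrict_pi_pi, integral_fintype_prod_eq_prod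
      (f := fun i (t : ℝ) => Complex.exp (ξ i * t * Complex.I))]
  -- The integral is a product over coordinates, so one nonzero frequency component suffices to kill
  -- it.
  obtain ⟨i, hi⟩ : ∃ i, ξ i ≠ 0 := by
    by_contra! h
    exact hξ (PiLp.ext h)
  exact Finset.prod_eq_zero (Finset.mem_univ i) (setIntegral_Ioc_exp_eq_zero hl hi (hint i))

/-- The plane wave `y ↦ exp (i ⟨ξ, y⟩)` on a bounded set. -/
noncomputable def expWave (hΩ : Bornology.IsBounded Ω) (ξ : Eucl n) :
    Lp ℂ 2 (volume.restrict Ω) :=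
  (memLp_restrict_of_continuous hΩ
    (f := fun y => Complex.exp ((inner ℝ ξ y : ℝ) * Complex.I)) (by fun_prop)).toLp _

theorem coeFn_expWave (hΩ : Bornology.IsBounded Ω) (ξ : Eucl n) :
    expWave hΩ ξ =ᵐ[volume.restrict Ω] fun y => Complex.exp ((inner ℝ ξ y : ℝ) * Complex.I) :=
  MemLp.coeFn_toLp _

theorem inner_expWave_expWave (hΩ : Bornology.IsBounded Ω) (ξ η : Eucl n) :
    inner ℂ (expWave hΩ ξ) (expWave hΩ η) =
      ∫ y in Ω, Complex.exp ((inner ℝ (η - ξ) y : ℝ) * Complex.I) := by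
  rw [MeasureTheory.L2.inner_def]
  refine integral_congr_ae ?_
  filter_upwards [coeFn_expWave hΩ ξ, coeFn_expWave hΩ η] with y h1 h2
  rw [h1, h2, RCLike.inner_apply, ← Complex.exp_conj, ← Complex.exp_add, inner_sub_left]
  congr 1
  simp
  ring

theorem inner_expWave_centeredCube {l : ℝ} (hl : 0 < l) {ξ η : Eucl n}
    (hξ : ∀ i, ∃ z : ℤ, l * ξ i = 2 * Real.pi * z) (hη : ∀ i, ∃ z : ℤ, l * η i = 2 * Real.pi * z) :
    inner ℂ (expWave (isBounded_centeredCube n l) ξ) (expWave (isBounded_centeredCube n l) η) =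
      if ξ = η then ((l ^ n : ℝ) : ℂ) else 0 := by
  rw [inner_expWave_expWave]
  split_ifs with h
  · subst h
    simp [volume_real_centeredCube n hl.le]
  · refine setIntegral_centeredCube_exp_eq_zero hl (sub_ne_zero.2 (Ne.symm h)) fun i => ?_
    obtain ⟨a, ha⟩ := hξ i
    obtain ⟨b, hb⟩ := hη i
    exact ⟨b - a, by simp [mul_sub, ha, hb]⟩

theorem orthonormal_expWave {l : ℝ} (hl : 0 < l) {s : Finset (Eucl n)}
    (hs : ∀ ξ ∈ s, ∀ i, ∃ z : ℤ, l * ξ i = 2 * Real.pi * z) :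
    Orthonormal ℂ fun ξ : s =>
      (((√(l ^ n))⁻¹ : ℝ) : ℂ) • expWave (isBounded_centeredCube n l) (ξ : Eucl n) := by
  classical
  rw [orthonormal_iff_ite]
  intro ξ η
  rw [inner_smul_left, inner_smul_right, inner_expWave_centeredCube hl (hs ξ ξ.2) (hs η η.2)]
  simp only [Subtype.ext_iff]
  split_ifs with h
  · have h1 : (√(l ^ n))⁻¹ * ((√(l ^ n))⁻¹ * l ^ n) = 1 := by
      have h2 : √(l ^ n) * √(l ^ n) = l ^ n := Real.mul_self_sqrt (by positivity)
      have h3 : √(l ^ n) ≠ 0 := (Real.sqrt_pos.2 (by positivity)).ne'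
      field_simp
      rw [sq, h2]
    rw [Complex.conj_ofReal]
    exact_mod_cast h1
  · simp

/-- Extension by zero, with complex values. -/
theorem memLp_indicator_ofReal (hm : MeasurableSet Ω) {Q : Set (Eucl n)} (hΩQ : Ω ⊆ Q)
    (f : L2 Ω) :
    MemLp (Ω.indicator fun x => ((f x : ℝ) : ℂ)) 2 (volume.restrict Q) := by
  rw [memLp_indicator_iff_restrict hm, Measure.restrict_restrict_of_subset hΩQ]
  exact (Lp.memLp f).ofReal

theorem norm_sq_toLp_indicator (hm : MeasurableSet Ω) {Q : Set (Eucl n)} (hΩQ : Ω ⊆ Q)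
    (f : L2 Ω) : ‖(memLp_indicator_ofReal hm hΩQ f).toLp‖ ^ 2 = ‖f‖ ^ 2 := by
  rw [Lp.norm_toLp, eLpNorm_indicator_eq_eLpNorm_restrict hm,
    Measure.restrict_restrict_of_subset hΩQ, Lp.norm_def]
  congr 2
  exact eLpNorm_congr_norm_ae (.of_forall fun x => by simp)

/-- For real `f`, the pairings with the cosine and sine waves are, up to sign, the real and
imaginary parts of the Fourier coefficient of its extension by zero. -/
theorem norm_sq_inner_expWave_toLp_indicator (hm : MeasurableSet Ω) (hΩ : Bornology.IsBounded Ω)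
    {Q : Set (Eucl n)} (hQ : Bornology.IsBounded Q) (hΩQ : Ω ⊆ Q) (f : L2 Ω) (ξ : Eucl n) :
    ‖inner ℂ (expWave hQ ξ) (memLp_indicator_ofReal hm hΩQ f).toLp‖ ^ 2 =
      inner ℝ (cosWave hΩ ξ) f ^ 2 + inner ℝ (sinWave hΩ ξ) f ^ 2 := by
  have h : inner ℂ (expWave hQ ξ) (memLp_indicator_ofReal hm hΩQ f).toLp =
      (inner ℝ (cosWave hΩ ξ) f : ℝ) + ((-inner ℝ (sinWave hΩ ξ) f : ℝ) : ℂ) * Complex.I := by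
    rw [MeasureTheory.L2.inner_def, L2.inner_eq_integral_mul, L2.inner_eq_integral_mul,
      ← integral_neg, ← integral_complex_ofReal, ← integral_complex_ofReal,
      ← integral_mul_const, ← integral_add (L2.integrable_mul _ _).ofReal
        ((L2.integrable_mul _ _).neg.ofReal.mul_const _),
      ← integral_indicator hm, ← setIntegral_eq_integral_of_forall_compl_eq_zero (s := Q)
        fun x hx => Set.indicator_of_notMem (fun h => hx (hΩQ h)) _]
    refine integral_congr_ae ?_
    have hc := (ae_restrict_iff' hm).1 (coeFn_cosWave hΩ ξ)
    have hs := (ae_restrict_iff' hm).1 (coeFn_sinWave hΩ ξ)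
    filter_upwards [coeFn_expWave hQ ξ, (memLp_indicator_ofReal hm hΩQ f).coeFn_toLp,
      ae_restrict_of_ae hc, ae_restrict_of_ae hs] with x h1 h2 h3 h4
    rw [h1, h2]
    by_cases hx : x ∈ Ω
    · rw [Set.indicator_of_mem hx, Set.indicator_of_mem hx, h3 hx, h4 hx,
        RCLike.inner_apply, Complex.exp_mul_I, ← Complex.ofReal_cos, ← Complex.ofReal_sin, map_add,
        map_mul, Complex.conj_ofReal, Complex.conj_ofReal, Complex.conj_I]
      push_cast
      ring
    · rw [Set.indicator_of_notMem hx, Set.indicator_of_notMem hx, inner_zero_right]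
  rw [h, ← Complex.normSq_eq_norm_sq, Complex.normSq_add_mul_I]
  ring

/-- Bessel's inequality on a bounded set for the plane waves with frequencies in a lattice. -/
theorem sum_inner_cosWave_sinWave_le (hm : MeasurableSet Ω) (hΩ : Bornology.IsBounded Ω) {l : ℝ}
    (hl : 0 < l) (hΩl : Ω ⊆ centeredCube n l) {s : Finset (Eucl n)}
    (hs : ∀ ξ ∈ s, ∀ i, ∃ z : ℤ, l * ξ i = 2 * Real.pi * z) (f : L2 Ω) :
    ∑ ξ ∈ s, (inner ℝ (cosWave hΩ ξ) f ^ 2 + inner ℝ (sinWave hΩ ξ) f ^ 2) ≤ l ^ n * ‖f‖ ^ 2 := by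
  have h := (orthonormal_expWave hl hs).sum_inner_products_le
    (memLp_indicator_ofReal hm hΩl f).toLp (s := Finset.univ)
  have hl' : 0 < l ^ n := by positivity
  rw [norm_sq_toLp_indicator hm hΩl f] at h
  have hterm : ∀ ξ : s, ‖inner ℂ ((((√(l ^ n))⁻¹ : ℝ) : ℂ) •
      expWave (isBounded_centeredCube n l) (ξ : Eucl n))
        (memLp_indicator_ofReal hm hΩl f).toLp‖ ^ 2 =
      (l ^ n)⁻¹ * (inner ℝ (cosWave hΩ ξ) f ^ 2 + inner ℝ (sinWave hΩ ξ) f ^ 2) := fun ξ => by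
    rw [inner_smul_left, norm_mul, mul_pow, Complex.conj_ofReal,
      norm_sq_inner_expWave_toLp_indicator hm hΩ _ hΩl, Complex.norm_real, Real.norm_eq_abs, sq_abs,
      inv_pow, Real.sq_sqrt hl'.le]
  rw [Finset.sum_congr rfl fun ξ _ => hterm ξ, ← Finset.mul_sum, Finset.sum_coe_sort s fun ξ =>
    inner ℝ (cosWave hΩ ξ) f ^ 2 + inner ℝ (sinWave hΩ ξ) f ^ 2] at h
  exact (inv_mul_le_iff₀ hl').1 h

end Bessel

/-! ### From lattice sums to the integral inequality -/

section TraceBound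

open Filter Topology
open scoped Pointwise

variable {n : ℕ} {Ω : Set (Eucl n)}

/-- The averaged variational principle for the plane waves with frequencies in a finite subset of
the lattice dual to `(lℤ)ⁿ`. -/
theorem sum_plateEigenvalue_add_le_sum (ho : IsOpen Ω) (hΩ : Bornology.IsBounded Ω) {τ σ : ℝ}
    (hτ : 0 ≤ τ) (hσ₀ : 0 ≤ σ) (hσ₁ : σ ≤ 1) {l : ℝ} (hl : 0 < l) (hΩl : Ω ⊆ centeredCube n l)
    {s : Finset (Eucl n)} (hs : ∀ ξ ∈ s, ∀ i, ∃ z : ℤ, l * ξ i = 2 * Real.pi * z) {k : ℕ}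
    (hk : k < volume.real Ω * ((∑ _ ∈ s, 1) / l ^ n)) :
    ∑ j ∈ Finset.range k, plateEigenvalue Ω τ σ (j + 1) +
        (volume.real Ω * ((∑ _ ∈ s, 1) / l ^ n) - k) * plateEigenvalue Ω τ σ (k + 1) ≤
      volume.real Ω * ((∑ ξ ∈ s, (‖ξ‖ ^ 4 + τ * ‖ξ‖ ^ 2)) / l ^ n) := by
  have hl' : 0 < l ^ n := by positivity
  -- Scaling by l^(−n/2) makes the Bessel constant equal to 1; cosines and sines form the two halves
  -- of the family `g`.
  set c := (√(l ^ n))⁻¹ with hc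
  have hcc : c * c = (l ^ n)⁻¹ := by rw [hc, ← mul_inv, Real.mul_self_sqrt hl'.le]
  let C : s → sobolevH2 Ω := fun ξ => ⟨cosWave hΩ (ξ : Eucl n), cosWave_mem hΩ _⟩
  let D : s → sobolevH2 Ω := fun ξ => ⟨sinWave hΩ (ξ : Eucl n), sinWave_mem hΩ _⟩
  let g : s ⊕ s → sobolevH2 Ω := Sum.elim (fun ξ => c • C ξ) (fun ξ => c • D ξ)
  have hinner : ∀ u x : sobolevH2 Ω,
      inner ℝ (c • u) x ^ 2 = (l ^ n)⁻¹ * inner ℝ (u : L2 Ω) (x : L2 Ω) ^ 2 := fun u x => by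
    change inner ℝ (c • (u : L2 Ω)) (x : L2 Ω) ^ 2 = _
    rw [real_inner_smul_left, mul_pow, sq c, hcc]
  have hnormc : ∀ u : sobolevH2 Ω, ‖c • u‖ ^ 2 = (l ^ n)⁻¹ * ‖(u : L2 Ω)‖ ^ 2 := fun u => by
    rw [norm_smul, mul_pow, Real.norm_eq_abs, sq_abs, sq c, hcc, Submodule.coe_norm]
  have hformc : ∀ u : sobolevH2 Ω,
      plateBilin ho τ σ (c • u) (c • u) = (l ^ n)⁻¹ * plateForm Ω τ σ u u := fun u => by
    rw [map_smul, map_smul, LinearMap.smul_apply, smul_eq_mul, smul_eq_mul, ← mul_assoc, hcc,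
      plateBilin_apply]
  have hbessel : ∀ x, ∑ i, inner ℝ (g i) x ^ 2 ≤ ‖x‖ ^ 2 := fun x => by
    have h := sum_inner_cosWave_sinWave_le ho.measurableSet hΩ hl hΩl hs (x : L2 Ω)
    rw [← inv_mul_le_iff₀ hl', ← Finset.sum_coe_sort, Finset.sum_add_distrib, mul_add,
      Finset.mul_sum, Finset.mul_sum] at h
    simp only [g, Fintype.sum_sum_type, Sum.elim_inl, Sum.elim_inr, hinner]
    exact h
  have hnorm : ∑ i, ‖g i‖ ^ 2 = volume.real Ω * ((∑ _ ∈ s, 1) / l ^ n) := by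
    simp only [g, Fintype.sum_sum_type, Sum.elim_inl, Sum.elim_inr, hnormc]
    rw [← Finset.sum_add_distrib]
    simp only [← mul_add, C, D, norm_sq_cosWave_add_norm_sq_sinWave]
    simp
    ring
  have hform : ∑ i, plateBilin ho τ σ (g i) (g i) =
      volume.real Ω * ((∑ ξ ∈ s, (‖ξ‖ ^ 4 + τ * ‖ξ‖ ^ 2)) / l ^ n) := by
    simp only [g, Fintype.sum_sum_type, Sum.elim_inl, Sum.elim_inr, hformc]
    rw [← Finset.sum_add_distrib]
    simp only [← mul_add, C, D, plateForm_cosWave_add_plateForm_sinWave ho]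
    rw [Finset.sum_coe_sort s fun ξ =>
      (l ^ n)⁻¹ * ((‖ξ‖ ^ 4 + τ * ‖ξ‖ ^ 2) * volume.real Ω), ← Finset.mul_sum, ← Finset.sum_mul]
    ring
  simp only [plateEigenvalue_eq_minMax ho]
  rw [← hnorm, ← hform]
  refine sum_minMax_add_le (fun u => ?_) (fun u v => ?_) g hbessel (by rwa [hnorm])
  · rw [plateBilin_apply]; exact plateForm_self_nonneg hτ hσ₀ hσ₁ _
  · rw [plateBilin_apply, plateBilin_apply, plateForm_comm]

/-- Polar coordinates reduce this to the integral of y^(n−1+p) over (0, r). -/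
theorem setIntegral_ball_norm_pow (hn : 1 ≤ n) {r : ℝ} (hr : 0 ≤ r) (p : ℕ) :
    ∫ ξ in Metric.ball (0 : Eucl n) r, ‖ξ‖ ^ p =
      n * unitBallVolume n * (r ^ (n + p) / (n + p)) := by
  have : Nontrivial (Eucl n) := by
    have : Nonempty (Fin n) := ⟨⟨0, hn⟩⟩
    infer_instance
  have h := integral_fun_norm_addHaar (volume : Measure (Eucl n))
    ((Set.Iio r).indicator fun y => y ^ p)
  have hl : ∫ ξ : Eucl n, (Set.Iio r).indicator (fun y => y ^ p) ‖ξ‖ =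
      ∫ ξ in Metric.ball (0 : Eucl n) r, ‖ξ‖ ^ p := by
    rw [← integral_indicator Metric.isOpen_ball.measurableSet]
    exact integral_congr_ae (.of_forall fun ξ => by simp [Set.indicator])
  have hr' : ∫ y in Set.Ioi (0 : ℝ), y ^ (n - 1) • (Set.Iio r).indicator (fun y => y ^ p) y =
      r ^ (n + p) / (n + p) := by
    have h1 : ∀ y : ℝ, y ^ (n - 1) • (Set.Iio r).indicator (fun y => y ^ p) y =
        (Set.Iio r).indicator (fun y => y ^ (n - 1 + p)) y := fun y => by
      by_cases hy : y < r <;> simp [hy, pow_add]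
    simp only [h1]
    rw [setIntegral_indicator measurableSet_Iio, Set.Ioi_inter_Iio, ← integral_Ioc_eq_integral_Ioo,
      ← intervalIntegral.integral_of_le hr, integral_pow]
    have h2 : n - 1 + p + 1 = n + p := by omega
    have h3 : ((n - 1 + p : ℕ) : ℝ) + 1 = n + p := by exact_mod_cast h2
    rw [h2, h3, zero_pow (by omega), sub_zero]
  rw [hl, finrank_euclideanSpace_fin, hr'] at h
  rw [h]
  simp [unitBallVolume, mul_assoc]

/-- Riemann sums over the lattice dual to `(lℤ)ⁿ` in a ball. -/
theorem exists_lattice_tendsto_setIntegral_ball (n : ℕ) (r : ℝ) :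
    ∃ S : ℕ → Finset (Eucl n),
      (∀ l : ℕ, 0 < l → ∀ ξ ∈ S l, ∀ i, ∃ z : ℤ, (l : ℝ) * ξ i = 2 * Real.pi * z) ∧
      ∀ F : Eucl n → ℝ, Continuous F → Tendsto (fun l : ℕ => (∑ ξ ∈ S l, F ξ) / (l : ℝ) ^ n) atTop
        (𝓝 (((2 * Real.pi) ^ n)⁻¹ * ∫ ξ in Metric.ball 0 r, F ξ)) := by
  classical
  have hpi : 0 < 2 * Real.pi := by positivity
  -- The factor 2π carries the lattice (1/l)ℤⁿ to the frequencies (2π/l)ℤⁿ, and produces the factor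
  -- (2π)^(−n) in the limit.
  let Φ : (Fin n → ℝ) →L[ℝ] Eucl n :=
    (2 * Real.pi) • ((PiLp.continuousLinearEquiv 2 ℝ (fun _ : Fin n => ℝ)).symm :
      (Fin n → ℝ) →L[ℝ] Eucl n)
  have hΦ : ∀ t, Φ t = (2 * Real.pi) • WithLp.toLp 2 t := fun t => rfl
  have hΦi : Function.Injective Φ := fun t u h => by
    rw [hΦ, hΦ] at h
    exact WithLp.toLp_injective 2 (smul_right_injective _ hpi.ne' h)
  set D := Φ ⁻¹' Metric.ball 0 r with hD
  have hDo : IsOpen D := Metric.isOpen_ball.preimage Φ.continuous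
  have hball : (2 * Real.pi) • Metric.ball (0 : Eucl n) (r / (2 * Real.pi)) = Metric.ball 0 r := by
    rw [smul_ball hpi.ne', smul_zero, Real.norm_of_nonneg hpi.le, mul_div_cancel₀ _ hpi.ne']
  have hD' : D = WithLp.toLp 2 ⁻¹' Metric.ball (0 : Eucl n) (r / (2 * Real.pi)) := by
    ext t
    rw [hD, Set.mem_preimage, hΦ, ← hball, Set.smul_mem_smul_set_iff₀ hpi.ne', Set.mem_preimage]
  have hDb : Bornology.IsBounded D := by
    rw [hD']
    exact (PiLp.antilipschitzWith_toLp 2 (fun _ : Fin n => ℝ)).isBounded_preimage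
      Metric.isBounded_ball
  -- Convergence of the Riemann sums needs a null boundary, which convexity supplies.
  have hDf : volume (frontier D) = 0 :=
    Convex.addHaar_frontier volume ((convex_ball 0 r).linear_preimage Φ.toLinearMap)
  have hfin : ∀ l : ℕ, 0 < l → (D ∩ (l : ℝ)⁻¹ •
      (Submodule.span ℤ (Set.range (Pi.basisFun ℝ (Fin n))) : Set (Fin n → ℝ))).Finite := by
    intro l hl
    rw [← Submodule.coe_pointwise_smul, ZSpan.smul _ (inv_ne_zero (Nat.cast_ne_zero.2 hl.ne'))]
    exact ZSpan.setFinite_inter _ hDb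
  refine ⟨fun l => if hl : 0 < l then (hfin l hl).toFinset.image Φ else ∅, ?_, ?_⟩
  · intro l hl ξ hξ i
    simp only [dif_pos hl, Finset.mem_image] at hξ
    obtain ⟨t, ht, rfl⟩ := hξ
    have : NeZero l := ⟨hl.ne'⟩
    obtain ⟨z, hz⟩ := BoxIntegral.unitPartition.mem_smul_span_iff.1
      ((hfin l hl).mem_toFinset.1 ht).2 i
    refine ⟨z, ?_⟩
    rw [hΦ]
    simp only [algebraMap_int_eq, eq_intCast] at hz
    simp [hz]
    ring
  · intro F hF
    have h := tendsto_tsum_div_pow_atTop_integral D (fun t => F (Φ t)) (hF.comp Φ.continuous) hDb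
      hDo.measurableSet hDf
    have hint : ∫ t in D, F (Φ t) = ((2 * Real.pi) ^ n)⁻¹ * ∫ ξ in Metric.ball 0 r, F ξ := by
      rw [hD']
      simp only [hΦ]
      rw [(PiLp.volume_preserving_toLp (Fin n)).setIntegral_preimage_emb
        (MeasurableEquiv.toLp 2 (Fin n → ℝ)).measurableEmbedding
        (fun x : Eucl n => F ((2 * Real.pi) • x)), Measure.setIntegral_comp_smul_of_pos _ _ _ hpi,
        hball, finrank_euclideanSpace_fin, smul_eq_mul]
    rw [hint] at h
    refine h.congr' ?_
    filter_upwards [eventually_gt_atTop 0] with l hl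
    rw [dif_pos hl, Finset.sum_image fun _ _ _ _ h => hΦi h, Fintype.card_fin,
      ← Finset.tsum_subtype' (hfin l hl).toFinset fun t => F (Φ t), (hfin l hl).coe_toFinset]

/-- Limit l → ∞ of the lattice inequality: the total squared norm tends to A rⁿ/(2π)ⁿ, so the strict
hypothesis on `k` holds for all large l. -/
theorem sum_plateEigenvalue_add_le (hn : 1 ≤ n) (ho : IsOpen Ω) (hΩ : Bornology.IsBounded Ω)
    {τ σ : ℝ} (hτ : 0 ≤ τ) (hσ₀ : 0 ≤ σ) (hσ₁ : σ ≤ 1) {k : ℕ} {r : ℝ} (hr : 0 ≤ r)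
    (hk : k * (2 * Real.pi) ^ n < unitBallVolume n * volume.real Ω * r ^ n) :
    (2 * Real.pi) ^ n * ∑ j ∈ Finset.range k, plateEigenvalue Ω τ σ (j + 1) +
        (unitBallVolume n * volume.real Ω * r ^ n - k * (2 * Real.pi) ^ n) *
          plateEigenvalue Ω τ σ (k + 1) ≤
      n * (unitBallVolume n * volume.real Ω) *
        (r ^ (n + 4) / (n + 4) + τ * (r ^ (n + 2) / (n + 2))) := by
  obtain ⟨S, hS, hlim⟩ := exists_lattice_tendsto_setIntegral_ball n r
  have hP : 0 < (2 * Real.pi) ^ n := by positivity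
  have hn0 : (n : ℝ) ≠ 0 := by positivity
  have h1 := (hlim (fun _ => 1) continuous_const).const_mul (volume.real Ω)
  have h2 := (hlim (fun ξ => ‖ξ‖ ^ 4 + τ * ‖ξ‖ ^ 2) (by fun_prop)).const_mul (volume.real Ω)
  have hint : ∀ p : ℕ, IntegrableOn (fun ξ : Eucl n => ‖ξ‖ ^ p) (Metric.ball 0 r) := fun p =>
    ((by fun_prop : Continuous fun ξ : Eucl n => ‖ξ‖ ^ p).continuousOn.integrableOn_compact
      (isCompact_closedBall 0 r)).mono_set Metric.ball_subset_closedBall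
  have hb0 : ∫ ξ in Metric.ball (0 : Eucl n) r, (1 : ℝ) = unitBallVolume n * r ^ n := by
    have := setIntegral_ball_norm_pow hn hr 0
    simp only [pow_zero, add_zero, Nat.cast_zero] at this
    rw [this]
    field_simp
  rw [hb0] at h1
  rw [integral_add (hint 4) ((hint 2).const_mul τ), integral_const_mul,
    setIntegral_ball_norm_pow hn hr, setIntegral_ball_norm_pow hn hr] at h2
  have hev1 := h1.eventually_const_lt (u := (k : ℝ)) (by
    rw [← mul_lt_mul_iff_left₀ hP]
    refine hk.trans_eq ?_
    field_simp)
  obtain ⟨R, hR⟩ := hΩ.subset_closedBall 0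
  have hle := le_of_tendsto_of_tendsto
    (((h1.sub_const (k : ℝ)).mul_const (plateEigenvalue Ω τ σ (k + 1))).const_add
      (∑ j ∈ Finset.range k, plateEigenvalue Ω τ σ (j + 1))) h2 (by
    filter_upwards [hev1, eventually_gt_atTop 0,
      tendsto_natCast_atTop_atTop.eventually_gt_atTop (2 * R)] with l hl1 hl0 hlR
    exact sum_plateEigenvalue_add_le_sum ho hΩ hτ hσ₀ hσ₁ (Nat.cast_pos.2 hl0)
      (subset_centeredCube hR hlR) (hS l hl0) hl1)
  have := mul_le_mul_of_nonneg_left hle hP.le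
  refine (Eq.le ?_).trans (this.trans_eq ?_)
  · field_simp
  · push_cast
    field_simp

end TraceBound

/-! ### Minimising the bound over the radius -/

section Optimization

open Filter Topology

/-- Near `a` and near infinity `f` is at least `f (a + 1)`, so a minimiser on a compact interval
containing `a + 1` is global. -/
theorem exists_isMinOn_Ioi {f : ℝ → ℝ} {a : ℝ} (hf : ContinuousOn f (Set.Ioi a))
    (ha : Tendsto f (𝓝[>] a) atTop) (htop : Tendsto f atTop atTop) :
    ∃ x ∈ Set.Ioi a, IsMinOn f (Set.Ioi a) x := by
  set M := f (a + 1)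
  obtain ⟨u, hu, hau⟩ := mem_nhdsGT_iff_exists_Ioo_subset.1 (ha.eventually_ge_atTop M)
  obtain ⟨b, hb⟩ := eventually_atTop.1 (htop.eventually_ge_atTop M)
  have hu' : a < u := hu
  obtain ⟨c, hac, hcu⟩ := exists_between (lt_min hu' (lt_add_one a))
  have hsub : Set.Icc c (max b (a + 1)) ⊆ Set.Ioi a := fun x hx => hac.trans_le hx.1
  have hmem : a + 1 ∈ Set.Icc c (max b (a + 1)) :=
    ⟨hcu.le.trans (min_le_right _ _), le_max_right _ _⟩
  obtain ⟨x, hx, hmin⟩ := isCompact_Icc.exists_isMinOn ⟨_, hmem⟩ (hf.mono hsub)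
  refine ⟨x, hsub hx, fun y hy => ?_⟩
  have hxM : f x ≤ M := hmin hmem
  by_cases h1 : y < c
  · exact hxM.trans (hau ⟨hy, h1.trans (hcu.trans_le (min_le_left _ _))⟩)
  by_cases h2 : y ≤ max b (a + 1)
  · exact hmin ⟨not_lt.1 h1, h2⟩
  · exact hxM.trans (hb y ((le_max_left _ _).trans (not_le.1 h2).le))

/-- The radius below which `plateBound` is not defined. -/
noncomputable def criticalRadius (n : ℕ) (t A : ℝ) : ℝ :=
  2 * Real.pi * (t / A) ^ ((1 : ℝ) / n)

variable {n : ℕ} {t A : ℝ}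

theorem criticalRadius_nonneg (ht : 0 ≤ t) (hA : 0 < A) : 0 ≤ criticalRadius n t A := by
  unfold criticalRadius; positivity

theorem criticalRadius_pow (ht : 0 ≤ t) (hA : 0 < A) (m : ℕ) :
    criticalRadius n t A ^ m = (2 * Real.pi) ^ m * (t / A) ^ ((m : ℝ) / n) := by
  rw [criticalRadius, mul_pow, ← Real.rpow_mul_natCast (by positivity)]
  congr 2
  ring

theorem mul_criticalRadius_pow (hn : 1 ≤ n) (ht : 0 ≤ t) (hA : 0 < A) :
    A * criticalRadius n t A ^ n = t * (2 * Real.pi) ^ n := by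
  have hn0 : (n : ℝ) ≠ 0 := by positivity
  rw [criticalRadius_pow ht hA, div_self hn0, Real.rpow_one]
  field_simp

theorem mul_pow_sub_pos (hn : 1 ≤ n) {k : ℕ} (hA : 0 < A) {r : ℝ}
    (hr : criticalRadius n k A < r) : 0 < A * r ^ n - k * (2 * Real.pi) ^ n := by
  rw [← mul_criticalRadius_pow hn (Nat.cast_nonneg k) hA, sub_pos]
  exact mul_lt_mul_of_pos_left
    (pow_lt_pow_left₀ hr (criticalRadius_nonneg (Nat.cast_nonneg k) hA) (by omega)) hA

theorem exists_isMinOn_plateBound (hn : 1 ≤ n) {k : ℕ} (hk : 1 ≤ k) (hA : 0 < A) {τ : ℝ}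
    (hτ : 0 ≤ τ) : ∃ r ∈ Set.Ioi (criticalRadius n k A),
      IsMinOn (plateBound n k A τ) (Set.Ioi (criticalRadius n k A)) r := by
  have hr0 : 0 < criticalRadius n k A := by unfold criticalRadius; positivity
  have hden : ∀ r ∈ Set.Ioi (criticalRadius n k A), 0 < A * r ^ n - k * (2 * Real.pi) ^ n :=
    fun r hr => mul_pow_sub_pos hn hA hr
  have hnpos : (0 : ℝ) < n := by positivity
  refine exists_isMinOn_Ioi ?_ ?_ ?_
  · unfold plateBound
    exact ContinuousOn.div (by fun_prop) (by fun_prop) fun r hr => (hden r hr).ne'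
  · have hnum : Tendsto (fun r : ℝ => n * A * (r ^ (n + 4) / (n + 4) + τ * (r ^ (n + 2) / (n + 2))))
        (𝓝[>] criticalRadius n k A) (𝓝 (n * A * (criticalRadius n k A ^ (n + 4) / (n + 4) +
          τ * (criticalRadius n k A ^ (n + 2) / (n + 2))))) :=
      (Continuous.tendsto (by fun_prop) _).mono_left nhdsWithin_le_nhds
    have hd : Tendsto (fun r : ℝ => A * r ^ n - k * (2 * Real.pi) ^ n)
        (𝓝[>] criticalRadius n k A) (𝓝[>] 0) := by
      refine tendsto_nhdsWithin_iff.2 ⟨?_, eventually_nhdsWithin_of_forall hden⟩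
      have : Tendsto (fun r : ℝ => A * r ^ n - k * (2 * Real.pi) ^ n) (𝓝 (criticalRadius n k A))
          (𝓝 (A * criticalRadius n k A ^ n - k * (2 * Real.pi) ^ n)) :=
        Continuous.tendsto (by fun_prop) _
      rw [mul_criticalRadius_pow hn (Nat.cast_nonneg k) hA, sub_self] at this
      exact this.mono_left nhdsWithin_le_nhds
    exact (hnum.pos_mul_atTop (by positivity) (tendsto_inv_nhdsGT_zero.comp hd)).congr
      fun r => (div_eq_mul_inv _ _).symm
  -- Dropping the tension and the subtracted part of the denominator leaves n r⁴/(n+4) as a lower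
  -- bound.
  · have hlow : Tendsto (fun r : ℝ => n / (n + 4) * r ^ 4) atTop atTop :=
      (tendsto_pow_atTop (by norm_num)).const_mul_atTop (by positivity)
    refine tendsto_atTop_mono' _ ?_ hlow
    filter_upwards [eventually_gt_atTop (criticalRadius n k A)] with r hr
    have hrpos : 0 < r := hr0.trans hr
    have hd := hden r hr
    rw [plateBound, le_div_iff₀ hd]
    have h1 : n / (n + 4) * r ^ 4 * (A * r ^ n - k * (2 * Real.pi) ^ n) ≤
        n / (n + 4) * r ^ 4 * (A * r ^ n) := by
      refine mul_le_mul_of_nonneg_left ?_ (by positivity)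
      have : 0 ≤ k * (2 * Real.pi) ^ n := by positivity
      linarith
    refine h1.trans ?_
    have h2 : n / (n + 4) * r ^ 4 * (A * r ^ n) = n * A * (r ^ (n + 4) / (n + 4)) := by
      rw [pow_add]; ring
    rw [h2]
    refine mul_le_mul_of_nonneg_left ?_ (by positivity)
    have : 0 ≤ τ * (r ^ (n + 2) / (n + 2)) := by positivity
    linarith

theorem plateBound_zero (hA : 0 < A) (τ : ℝ) {r : ℝ} (hr : 0 < r) :
    plateBound n 0 A τ r = n * (r ^ 4 / (n + 4) + τ * (r ^ 2 / (n + 2))) := by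
  unfold plateBound
  simp only [Nat.cast_zero, zero_mul, sub_zero, pow_add]
  field_simp

theorem criticalRadius_zero (hn : 1 ≤ n) : criticalRadius n (0 : ℕ) A = 0 := by
  have : (n : ℝ) ≠ 0 := by positivity
  simp [criticalRadius, this]

/-- For `k = 0` the factor A rⁿ cancels, and the remaining expression tends to 0 as r → 0 while
staying nonnegative. -/
theorem isGLB_plateBound_zero (hn : 1 ≤ n) (hA : 0 < A) {τ : ℝ} (hτ : 0 ≤ τ) :
    IsGLB (plateBound n 0 A τ '' Set.Ioi (criticalRadius n (0 : ℕ) A)) 0 := by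
  rw [criticalRadius_zero hn]
  constructor
  · rintro _ ⟨r, hr, rfl⟩
    have hr' : 0 < r := hr
    rw [plateBound_zero hA τ hr]
    positivity
  · intro b hb
    have hlim : Tendsto (fun r : ℝ => n * (r ^ 4 / (n + 4) + τ * (r ^ 2 / (n + 2)))) (𝓝[>] 0)
        (𝓝 (n * (0 ^ 4 / (n + 4) + τ * (0 ^ 2 / (n + 2))))) :=
      (Continuous.tendsto (by fun_prop) _).mono_left nhdsWithin_le_nhds
    have := ge_of_tendsto hlim (eventually_nhdsWithin_of_forall (a := (0 : ℝ)) (s := Set.Ioi 0)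
      fun r hr => (hb ⟨r, hr, rfl⟩).trans_eq (plateBound_zero hA τ hr))
    simpa using this

/-- The optimal radius in the absence of tension. -/
theorem plateBound_criticalRadius (hn : 1 ≤ n) {k : ℕ} (hk : 1 ≤ k) (hA : 0 < A) :
    plateBound n k A 0 (criticalRadius n ((n + 4) / 4 * k) A) =
      criticalRadius n ((n + 4) / 4 * k) A ^ 4 := by
  have hnpos : (0 : ℝ) < n := by positivity
  have hkpos : (0 : ℝ) < k := by positivity
  have hP : 0 < (2 * Real.pi) ^ n := by positivity
  have h := mul_criticalRadius_pow (t := (n + 4) / 4 * k) hn (by positivity) hA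
  rw [plateBound, h, zero_mul, add_zero, pow_add]
  generalize criticalRadius n ((n + 4) / 4 * k) A = ρ at h ⊢
  -- The factor (n+4)/4 solves the critical point equation 4 A rⁿ = (n+4) k (2π)ⁿ of r^(n+4)/(A rⁿ −
  -- k(2π)ⁿ).
  have h1 : (n + 4) / 4 * k * (2 * Real.pi) ^ n - k * (2 * Real.pi) ^ n =
      n / 4 * (k * (2 * Real.pi) ^ n) := by ring
  rw [h1, div_eq_iff (by positivity)]
  have h2 : (n : ℝ) + 4 ≠ 0 := by positivity
  field_simp
  linear_combination (4 * ρ ^ 4) * h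

end Optimization

/-! ### The eigenvalue bounds -/

section Main

open Filter Topology

variable {n : ℕ} {Ω : Set (Eucl n)}

theorem plateEigenvalue_succ_nonneg (ho : IsOpen Ω) {τ σ : ℝ} (hτ : 0 ≤ τ) (hσ₀ : 0 ≤ σ)
    (hσ₁ : σ ≤ 1) (k : ℕ) : 0 ≤ plateEigenvalue Ω τ σ (k + 1) := by
  rw [plateEigenvalue_eq_minMax ho]
  refine minMax_succ_nonneg (fun u => ?_) k
  rw [plateBilin_apply]
  exact plateForm_self_nonneg hτ hσ₀ hσ₁ _

theorem unitBallVolume_mul_pos (ho : IsOpen Ω) (hne : Ω.Nonempty) (hΩ : Bornology.IsBounded Ω) :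
    0 < unitBallVolume n * volume.real Ω := by
  refine mul_pos ?_ ?_
  · exact ENNReal.toReal_pos (Metric.measure_ball_pos volume 0 one_pos).ne' measure_ball_lt_top.ne
  · exact ENNReal.toReal_pos (ho.measure_pos volume hne).ne' hΩ.measure_lt_top.ne

theorem plateEigenvalue_succ_le_plateBound (hn : 1 ≤ n) (ho : IsOpen Ω) (hne : Ω.Nonempty)
    (hΩ : Bornology.IsBounded Ω) {τ σ : ℝ} (hτ : 0 ≤ τ) (hσ₀ : 0 ≤ σ) (hσ₁ : σ ≤ 1) {k : ℕ}
    {r : ℝ} (hr : criticalRadius n k (unitBallVolume n * volume.real Ω) < r) :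
    plateEigenvalue Ω τ σ (k + 1) ≤ plateBound n k (unitBallVolume n * volume.real Ω) τ r := by
  have hA := unitBallVolume_mul_pos ho hne hΩ
  have hd := mul_pow_sub_pos hn hA hr
  have h := sum_plateEigenvalue_add_le hn ho hΩ hτ hσ₀ hσ₁ (k := k)
    ((criticalRadius_nonneg (Nat.cast_nonneg k) hA).trans hr.le) (sub_pos.1 hd)
  have hs : 0 ≤ (2 * Real.pi) ^ n * ∑ j ∈ Finset.range k, plateEigenvalue Ω τ σ (j + 1) :=
    mul_nonneg (by positivity)
      (Finset.sum_nonneg fun j _ => plateEigenvalue_succ_nonneg ho hτ hσ₀ hσ₁ j)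
  rw [plateBound, le_div_iff₀ hd]
  linarith

/-- As r decreases to the critical radius, the nonnegative Λ_{k+1} term can be discarded at each r,
and the right side is continuous. At the limit A rⁿ = k(2π)ⁿ, which turns the prefactor n A into n
k. -/
theorem sum_range_plateEigenvalue_le (hn : 1 ≤ n) (ho : IsOpen Ω) (hne : Ω.Nonempty)
    (hΩ : Bornology.IsBounded Ω) {τ σ : ℝ} (hτ : 0 ≤ τ) (hσ₀ : 0 ≤ σ) (hσ₁ : σ ≤ 1) (k : ℕ) :
    ∑ j ∈ Finset.range k, plateEigenvalue Ω τ σ (j + 1) ≤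
      n * k * (criticalRadius n k (unitBallVolume n * volume.real Ω) ^ 4 / (n + 4) +
        τ * (criticalRadius n k (unitBallVolume n * volume.real Ω) ^ 2 / (n + 2))) := by
  have hA := unitBallVolume_mul_pos ho hne hΩ
  set A := unitBallVolume n * volume.real Ω
  set ρ := criticalRadius n k A
  have hP : 0 < (2 * Real.pi) ^ n := by positivity
  have hlim : Tendsto (fun r : ℝ => n * A * (r ^ (n + 4) / (n + 4) + τ * (r ^ (n + 2) / (n + 2))))
      (𝓝[>] ρ) (𝓝 (n * A * (ρ ^ (n + 4) / (n + 4) + τ * (ρ ^ (n + 2) / (n + 2))))) :=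
    (Continuous.tendsto (by fun_prop) _).mono_left nhdsWithin_le_nhds
  have h := ge_of_tendsto hlim (b := (2 * Real.pi) ^ n *
      ∑ j ∈ Finset.range k, plateEigenvalue Ω τ σ (j + 1))
    (eventually_nhdsWithin_of_forall fun r hr => by
      have hd := mul_pow_sub_pos hn hA hr
      have h := sum_plateEigenvalue_add_le hn ho hΩ hτ hσ₀ hσ₁ (k := k)
        ((criticalRadius_nonneg (Nat.cast_nonneg k) hA).trans (le_of_lt hr)) (sub_pos.1 hd)
      have := mul_nonneg hd.le (plateEigenvalue_succ_nonneg ho hτ hσ₀ hσ₁ k)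
      linarith)
  have hρ : A * ρ ^ n = k * (2 * Real.pi) ^ n := mul_criticalRadius_pow hn (Nat.cast_nonneg k) hA
  refine le_of_mul_le_mul_left (h.trans_eq ?_) hP
  rw [pow_add, pow_add]
  linear_combination (n * (ρ ^ 4 / (n + 4) + τ * (ρ ^ 2 / (n + 2)))) * hρ

theorem sum_Icc_plateEigenvalue_le (hn : 1 ≤ n) (ho : IsOpen Ω) (hne : Ω.Nonempty)
    (hΩ : Bornology.IsBounded Ω) {τ σ : ℝ} (hτ : 0 ≤ τ) (hσ₀ : 0 ≤ σ) (hσ₁ : σ ≤ 1) {k : ℕ}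
    (hk : 1 ≤ k) :
    ∑ j ∈ Finset.Icc 1 k, plateEigenvalue Ω τ σ j ≤
        (2 * Real.pi) ^ 4 * ((n : ℝ) / (n + 4)) * (k : ℝ) ^ (((n : ℝ) + 4) / n) *
            (1 / (unitBallVolume n * volume.real Ω)) ^ ((4 : ℝ) / n)
          + τ * (2 * Real.pi) ^ 2 * ((n : ℝ) / (n + 2)) * (k : ℝ) ^ (((n : ℝ) + 2) / n) *
            (1 / (unitBallVolume n * volume.real Ω)) ^ ((2 : ℝ) / n) := by
  have hA := unitBallVolume_mul_pos ho hne hΩ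
  have h := sum_range_plateEigenvalue_le hn ho hne hΩ hτ hσ₀ hσ₁ k
  set A := unitBallVolume n * volume.real Ω
  have hsum : ∑ j ∈ Finset.Icc 1 k, plateEigenvalue Ω τ σ j =
      ∑ j ∈ Finset.range k, plateEigenvalue Ω τ σ (j + 1) := by
    rw [Finset.range_eq_Ico, Finset.sum_Ico_add' (plateEigenvalue Ω τ σ) 0 k 1]
    rfl
  have hn0 : (n : ℝ) ≠ 0 := by positivity
  have hk0 : (0 : ℝ) < k := by positivity
  have hpow : ∀ m : ℕ, (k : ℝ) * criticalRadius n k A ^ m =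
      (2 * Real.pi) ^ m * ((k : ℝ) ^ (((n : ℝ) + m) / n) * (1 / A) ^ ((m : ℝ) / n)) := fun m => by
    rw [criticalRadius_pow hk0.le hA, add_div, div_self hn0, Real.rpow_add hk0, Real.rpow_one,
      div_eq_mul_one_div (k : ℝ) A, Real.mul_rpow hk0.le (by positivity)]
    ring
  rw [hsum]
  refine h.trans_eq ?_
  have h4 := hpow 4
  have h2 := hpow 2
  push_cast at h4 h2
  linear_combination (n / (n + 4) : ℝ) * h4 + (τ * (n / (n + 2)) : ℝ) * h2

end Main

theorem theorem2 (n : ℕ) (hn : 1 ≤ n) (Ω : Set (Eucl n)) (hΩ : IsBoundedSmoothDomain Ω)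
    (τ σ : ℝ) (hτ : 0 ≤ τ) (hσ₀ : 0 ≤ σ) (hσ₁ : σ ≤ 1) :
    -- the numbers `Λ_k` are the eigenvalues of the boundary value problem
    (∀ μ : ℕ → ℝ, IsPlateSpectrum Ω τ σ μ → ∀ j, μ j = plateEigenvalue Ω τ σ (j + 1)) ∧
    -- (i)
    (∀ k : ℕ, 1 ≤ k →
      ∑ j ∈ Finset.Icc 1 k, plateEigenvalue Ω τ σ j ≤
        (2 * Real.pi) ^ 4 * ((n : ℝ) / (n + 4)) * (k : ℝ) ^ (((n : ℝ) + 4) / n) *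
            (1 / (unitBallVolume n * volume.real Ω)) ^ ((4 : ℝ) / n)
          + τ * (2 * Real.pi) ^ 2 * ((n : ℝ) / (n + 2)) * (k : ℝ) ^ (((n : ℝ) + 2) / n) *
            (1 / (unitBallVolume n * volume.real Ω)) ^ ((2 : ℝ) / n)) ∧
    -- (ii)
    (τ = 0 → ∀ k : ℕ,
      plateEigenvalue Ω τ σ (k + 1) ≤
        (2 * Real.pi) ^ 4 *
          (((n : ℝ) + 4) / (4 * (unitBallVolume n * volume.real Ω))) ^ ((4 : ℝ) / n) *
          (k : ℝ) ^ ((4 : ℝ) / n)) ∧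
    -- (iii), where the infimum is a minimum if `k ≥ 1`
    (0 < τ → ∀ k : ℕ, ∃ m : ℝ,
      IsGLB (plateBound n k (unitBallVolume n * volume.real Ω) τ ''
        Set.Ioi (2 * Real.pi * ((k : ℝ) / (unitBallVolume n * volume.real Ω)) ^ ((1 : ℝ) / n))) m ∧
      (1 ≤ k → m ∈ plateBound n k (unitBallVolume n * volume.real Ω) τ ''
        Set.Ioi (2 * Real.pi * ((k : ℝ) / (unitBallVolume n * volume.real Ω)) ^ ((1 : ℝ) / n))) ∧
      plateEigenvalue Ω τ σ (k + 1) ≤ m) := by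
  have ho := hΩ.isOpen
  have hne := hΩ.isConnected.nonempty
  have hb := hΩ.isBounded
  have hA := unitBallVolume_mul_pos ho hne hb
  have hn0 : (n : ℝ) ≠ 0 := by positivity
  have hbound : ∀ k : ℕ, ∀ r ∈ Set.Ioi (criticalRadius n k (unitBallVolume n * volume.real Ω)),
      plateEigenvalue Ω τ σ (k + 1) ≤ plateBound n k (unitBallVolume n * volume.real Ω) τ r :=
    fun k r hr => plateEigenvalue_succ_le_plateBound hn ho hne hb hτ hσ₀ hσ₁ hr
  have hzero : plateEigenvalue Ω τ σ (0 + 1) ≤ 0 :=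
    (isGLB_plateBound_zero hn hA hτ).2 (by rintro _ ⟨r, hr, rfl⟩; exact hbound 0 r hr)
  refine ⟨fun μ hμ j => hμ.eq_plateEigenvalue ho hτ hσ₀ hσ₁ j,
    fun k hk => sum_Icc_plateEigenvalue_le hn ho hne hb hτ hσ₀ hσ₁ hk, ?_, ?_⟩
  · rintro rfl k
    -- For `k = 0` the optimal radius degenerates to the excluded endpoint 0, so the limit r → 0 in
    -- `hzero` is used instead.
    rcases Nat.eq_zero_or_pos k with rfl | hk
    · simpa [hn0] using hzero
    set A := unitBallVolume n * volume.real Ω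
    have hk0 : (0 : ℝ) < k := by positivity
    have hlt : criticalRadius n k A < criticalRadius n ((n + 4) / 4 * k) A := by
      have hn' : (0 : ℝ) < n := by positivity
      unfold criticalRadius
      gcongr
      nlinarith
    refine (hbound k _ hlt).trans_eq ?_
    rw [plateBound_criticalRadius hn hk hA, criticalRadius_pow (by positivity) hA, mul_assoc,
      ← Real.mul_rpow (by positivity) hk0.le]
    congr 2
    field_simp
  · intro _ k
    change ∃ m : ℝ,
      IsGLB (_ '' Set.Ioi (criticalRadius n k (unitBallVolume n * volume.real Ω))) m ∧
      (1 ≤ k → m ∈ _ '' Set.Ioi (criticalRadius n k (unitBallVolume n * volume.real Ω))) ∧ _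
    rcases Nat.eq_zero_or_pos k with rfl | hk
    · exact ⟨0, isGLB_plateBound_zero hn hA hτ, fun h => absurd h (by norm_num), hzero⟩
    · obtain ⟨r, hr, hmin⟩ := exists_isMinOn_plateBound hn hk hA hτ
      exact ⟨_, IsLeast.isGLB ⟨⟨r, hr, rfl⟩, by rintro _ ⟨y, hy, rfl⟩; exact hmin hy⟩,
        fun _ => ⟨r, hr, rfl⟩, hbound k r hr⟩
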